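/- **Theorem (twisted Eilenberg–Zilber).** Let $F$ and $B$ be simplicial sets, $G$ a simplicial group acting (on the left, simplicially) on $F$, and let $\tau=(\tau_n\colon B_{n}\to G_{n-1})_{n>0}$ be a twisting function, i.e. $\partial_0\tau(b)=\tau(\partial_0b)^{-1}\tau(\partial_1b)$, $\partial_i\tau(b)=\tau(\partial_{i+1}b)$ for $i>0$, $\eta_i\tau(b)=\tau(\eta_{i+1}b)$ for $i\ge 0$, and $\tau(\eta_0b)=e$. Let $F\times_\tau B$ be the twisted product: it has the simplices, degeneracies and faces $\partial_i$, $i>0$, of $F\times B$, but $\partial_0(f,b)=(\tau(b)\cdot\partial_0f,\partial_0b)$. $C_*$ denotes normalized chains with integer coefficients, with the non-degenerate simplices as distinguished basis (cells); $F\times B$ and $F\times_\tau B$ have the same cells. *The Eilenberg–Zilber vector field.* A non-degenerate $n$-simplex of $F\times B$ is uniquely of the form $(\eta^*\phi,\theta^*\beta)$ with $\eta\colon[n]\to[p]$, $\theta\colon[n]\to[q]$ monotone surjections and $\phi\in F_p$, $\beta\in B_q$ non-degenerate; $(p,q)$ is its bidimension, and the points $(\eta(k),\theta(k))$, $0\le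 k\le n$, form a lattice path from $(0,0)$ to $(p,q)$ with steps $(1,0)$ (horizontal), $(0,1)$ (vertical) or $(1,1)$ (diagonal). Run the path backward from $(p,q)$. The simplex is called a *source* if the first event met is a diagonal step, a *target* if it is a bend consisting (in the forward direction) of a vertical step followed by a horizontal step, and *critical* if there is no such event. The vector field $V$ of $F\times B$ is the set of all pairs $(\partial_j\rho,\rho)$ where $\rho$ is a target, $j$ is the index of the vertex of its bend (so $j>0$), and the face is taken in $F\times B$. Then, on $C_*(F\times_\tau B)$: 1. The same collection of pairs $V$ is a discrete vector field: in each pair $(\sigma,\rho)$ the coefficient of $\sigma$ in $d\rho$ is $\pm1$, and every cell occurs at most once in $V$. A cell is the first component of a pair, the second component of a pair, or in no pair, according as it is a source, a target, or critical in the above sense. 2. $V$ is admissible: for every cell $\sigma$ there is a bound $\lambda(\sigma)\in\mathbb N$ for the lengths of the sequences $(\sigma_0,\rho_0),(\sigma_1,\rho_1),\dots$ of elements of $V$ with $\sigma_0=\sigma$ in which each $\sigma_{k+1}\ne\sigma_k$ has a non-zero coefficient in $d\rho_k$. Moreover the function $(q,p,L)$, compared lexicographically, is a Lyapunov function, i.e.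 it decreases strictly from each $\sigma_k$ to $\sigma_{k+1}$; here $(p,q)$ is the bidimension of the cell and $L$ the number of points of $\{0,\dots,p\}\times\{0,\dots,q\}$ strictly above its path. 3. Consequently $V$ defines a reduction $$TEZ=(f,g,h)\colon C_*(F\times_\tau B)\Rightarrow C_*(F)\otimes_tC_*(B),$$ that is, $f,g$ are chain maps, $h$ has degree $+1$, $fg=1$, $gf+dh+hd=1$, $fh=0$, $hg=0$, $hh=0$. The small complex has the same underlying graded module $\bigoplus_{p+q=n}C_p(F)\otimes C_q(B)$ as $C_*(F)\otimes C_*(B)$, with some differential $d_t$. This graded module is identified with the free module on the critical cells by sending $\phi\otimes\beta$, for non-degenerate $\phi\in F_p$, $\beta\in B_q$, to the critical cell of bidimension $(p,q)$ over $(\phi,\beta)$, whose path is $(0,0),\dots,(p,0),(p,1),\dots,(p,q)$. With respect to the decomposition of $C_*(F\times_\tau B)$ into target, source and critical parts (indices $1,2,3$), the component $d_{2,1}$ is an isomorphism and $$f=\begin{pmatrix}0&-d_{3,1}d_{2,1}^{-1}&1\end{pmatrix},\quad g=\begin{pmatrix}-d_{2,1}^{-1}d_{2,3}\\0\\1\end{pmatrix},\quad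 h=d_{2,1}^{-1}\text{ on the source part and }0\text{ on the other two},$$ so that $d_t=d_{3,3}-d_{3,1}d_{2,1}^{-1}d_{2,3}$. -/

import Mathlib

open CategoryTheory Simplicial Opposite MonoidalCategory

open scoped TensorProduct DirectSum

universe u w

noncomputable section

namespace TwistedEZ

/-! ### Algebraic cellular complexes -/

/-- A (non-negatively graded) algebraic cellular complex: the chain group in degree `n` is the
free `ℤ`-module on the distinguished basis `cell n`. -/
structure CellComplex where
  cell : ℕ → Type u
  bd : ∀ n, (cell (n + 1) →₀ ℤ) →ₗ[ℤ] (cell n →₀ ℤ)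
  bd_comp_bd : ∀ n, bd n ∘ₗ bd (n + 1) = 0

/-- The underlying chain complex of an algebraic cellular complex. -/
def CellComplex.chain (C : CellComplex.{u}) : ChainComplex (ModuleCat.{u} ℤ) ℕ :=
  ChainComplex.of (fun n => ModuleCat.of ℤ (C.cell n →₀ ℤ)) (fun n => ModuleCat.ofHom (C.bd n))
    (fun n => by rw [← ModuleCat.ofHom_comp, C.bd_comp_bd]; rfl)

section VectorFields

variable (C : CellComplex.{u})

/-- The coefficient of `s` in the boundary of `t`. -/
def incidence {n : ℕ} (s : C.cell n) (t : C.cell (n + 1)) : ℤ :=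
  C.bd n (Finsupp.single t 1) s

def IsFace {n : ℕ} (s : C.cell n) (t : C.cell (n + 1)) : Prop := incidence C s t ≠ 0

def IsRegularFace {n : ℕ} (s : C.cell n) (t : C.cell (n + 1)) : Prop :=
  incidence C s t = 1 ∨ incidence C s t = -1

/-- A collection of pairs `(s, t)` with `s` an `n`-cell and `t` an `(n + 1)`-cell. -/
abbrev PairFamily : Type u := ∀ n, C.cell n → C.cell (n + 1) → Prop

variable {C} (V : PairFamily C)

/-- A discrete vector field: in every vector the source is a regular face of the target, and
every cell occurs at most once in the whole collection. -/
structure IsDiscreteVectorField : Prop where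
  regular : ∀ {n} {s : C.cell n} {t : C.cell (n + 1)}, V n s t → IsRegularFace C s t
  target_unique : ∀ {n} {s : C.cell n} {t t' : C.cell (n + 1)}, V n s t → V n s t' → t = t'
  source_unique : ∀ {n} {s s' : C.cell n} {t : C.cell (n + 1)}, V n s t → V n s' t → s = s'
  not_source_of_target : ∀ {n} {s : C.cell n} {t : C.cell (n + 1)} {r : C.cell (n + 2)},
    V n s t → ¬ V (n + 1) t r

def IsSource {n : ℕ} (s : C.cell n) : Prop := ∃ t, V n s t

/-- The cell `t` is the second component of a vector. -/
def IsTarget {n : ℕ} (t : C.cell n) : Prop :=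
  match n, t with
  | 0, _ => False
  | m + 1, t => ∃ s : C.cell m, V m s t

def IsCritical {n : ℕ} (c : C.cell n) : Prop := ¬ IsSource V c ∧ ¬ IsTarget V c

/-- A `V`-path: a finite sequence of vectors in which the source of each vector but the first is
a face of the target of the previous vector, different from the source of that vector. -/
def IsVPath (n : ℕ) (l : List (C.cell n × C.cell (n + 1))) : Prop :=
  (∀ v ∈ l, V n v.1 v.2) ∧ l.IsChain (fun v v' => IsFace C v'.1 v.2 ∧ v'.1 ≠ v.1)

/-- The length of the `V`-paths starting from a given cell is bounded. -/
def IsAdmissible : Prop :=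
  ∃ bound : ∀ n, C.cell n → ℕ, ∀ n v l, IsVPath V n (v :: l) → (v :: l).length ≤ bound n v.1

/-- A Lyapunov function for `V` with values in an ordered set. -/
def IsLyapunov {α : Type*} [LT α] (L : ∀ n, C.cell n → α) : Prop :=
  ∀ n (s s' : C.cell n) (t t' : C.cell (n + 1)), V n s t → V n s' t' →
    IsFace C s' t → s' ≠ s → L n s' < L n s

/-- The chains whose support consists of cells with the property `P`. -/
def spanOf {n : ℕ} (P : C.cell n → Prop) : Submodule ℤ (C.cell n →₀ ℤ) :=
  Finsupp.supported ℤ ℤ {c | P c}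

/-- The component of a chain on the cells with the property `P`. -/
def component {n : ℕ} (P : C.cell n → Prop) : (C.cell n →₀ ℤ) →ₗ[ℤ] (C.cell n →₀ ℤ) := by
  classical exact Finsupp.linearCombination ℤ (fun c => if P c then Finsupp.single c 1 else 0)

end VectorFields

/-! ### Reductions -/

/-- A reduction `(f, g, h)` of a chain complex `C` onto a chain complex `D`: `f` and `g` are chain
maps, `h` has degree `+1`, `f g = 1`, `g f + d h + h d = 1`, `f h = 0`, `h g = 0`, `h h = 0`. -/
structure Reduction {R : Type*} [Ring R] (C D : ChainComplex (ModuleCat.{u} R) ℕ) where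
  f : C ⟶ D
  g : D ⟶ C
  h : Homotopy (𝟙 C) (f ≫ g)
  g_f : g ≫ f = 𝟙 D
  h_f : ∀ n, h.hom n (n + 1) ≫ f.f (n + 1) = 0
  g_h : ∀ n, g.f n ≫ h.hom n (n + 1) = 0
  h_h : ∀ n, h.hom n (n + 1) ≫ h.hom (n + 1) (n + 2) = 0

section

variable {C : CellComplex.{u}} {D : ChainComplex (ModuleCat.{u} ℤ) ℕ} (ρ : Reduction C.chain D)

/-- The component of `f` in degree `n`. -/
def Reduction.fMap (n : ℕ) : (C.cell n →₀ ℤ) →ₗ[ℤ] D.X n := (ρ.f.f n).hom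

/-- The component of `g` in degree `n`. -/
def Reduction.gMap (n : ℕ) : D.X n →ₗ[ℤ] (C.cell n →₀ ℤ) := (ρ.g.f n).hom

/-- The component of `h` from degree `n` to degree `n + 1`. -/
def Reduction.hMap (n : ℕ) : (C.cell n →₀ ℤ) →ₗ[ℤ] (C.cell (n + 1) →₀ ℤ) :=
  (ρ.h.hom n (n + 1)).hom

end

/-- The reduction `ρ` of the cellular complex `C` is the one which the vector field `V` defines by
Gauss elimination, where the graded module of the small complex `D` is identified by `κ` with the
free module on the critical cells. In block form, with respect to the decomposition of the chains
of `C` into target, source and critical components: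

* `h` vanishes on the target and critical components, and from source chains to target chains it
  is the inverse of the component `d₂₁` of `d` going from target chains to source chains;
* `f = [0, - d₃₁ d₂₁⁻¹, 1]`, that is, `f` is the critical component of `1 - d h`;
* `g = [- d₂₁⁻¹ d₂₃, 0, 1]ᵗ`, that is, `g` is the restriction of `1 - h d` to critical chains.

The differential of `D` is then forced to be `d₃₃ - d₃₁ d₂₁⁻¹ d₂₃`. -/
structure IsInducedBy {C : CellComplex.{u}} {D : ChainComplex (ModuleCat.{u} ℤ) ℕ}
    (ρ : Reduction C.chain D) (V : PairFamily C)
    (κ : ∀ n, D.X n ≃ₗ[ℤ] spanOf (fun c : C.cell n => IsCritical V c)) : Prop where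
  h_target : ∀ n (c : C.cell n), IsTarget V c →
    ρ.hMap n (Finsupp.single c 1) = 0
  h_critical : ∀ n (c : C.cell n), IsCritical V c →
    ρ.hMap n (Finsupp.single c 1) = 0
  h_source_mem : ∀ n (c : C.cell n), IsSource V c →
    ρ.hMap n (Finsupp.single c 1) ∈ spanOf (fun t : C.cell (n + 1) => IsTarget V t)
  d_h_source : ∀ n (c : C.cell n), IsSource V c →
    component (IsSource V) (C.bd n (ρ.hMap n (Finsupp.single c 1))) =
      Finsupp.single c 1
  h_d_target : ∀ n (c : C.cell (n + 1)), IsTarget V c →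
    ρ.hMap n (component (IsSource V) (C.bd n (Finsupp.single c 1))) =
      Finsupp.single c 1
  f_eq : ∀ n x, (κ n (ρ.fMap n x) : C.cell n →₀ ℤ) =
    component (IsCritical V) (x - C.bd n (ρ.hMap n x))
  g_zero : ∀ y, ρ.gMap 0 y = (κ 0 y : C.cell 0 →₀ ℤ)
  g_succ : ∀ n y, ρ.gMap (n + 1) y =
    (κ (n + 1) y : C.cell (n + 1) →₀ ℤ) - ρ.hMap n (C.bd n (κ (n + 1) y))

/-! ### The normalized chain complex of a simplicial set -/

section Normalized

variable (X : SSet.{u})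

/-- The class of a simplex in the normalized chains: the simplex itself if it is non-degenerate
and zero if it is degenerate. -/
def simplexChain {n : ℕ} (x : X _⦋n⦌) : X.nonDegenerate n →₀ ℤ := by
  classical exact if hx : x ∈ X.nonDegenerate n then Finsupp.single ⟨x, hx⟩ 1 else 0

/-- The alternating sum of the faces, where the degenerate faces are cancelled. -/
def normBd (n : ℕ) : (X.nonDegenerate (n + 1) →₀ ℤ) →ₗ[ℤ] (X.nonDegenerate n →₀ ℤ) :=
  Finsupp.linearCombination ℤ
    (fun x => ∑ i : Fin (n + 2), (-1 : ℤ) ^ (i : ℕ) • simplexChain X (X.δ i x.1))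

lemma simplexChain_of_degenerate {n : ℕ} {x : X _⦋n⦌} (hx : x ∈ X.degenerate n) :
    simplexChain X x = 0 := by
  classical
  unfold simplexChain
  rw [dif_neg]
  simpa [SSet.nonDegenerate] using hx

lemma simplexChain_of_nonDegenerate {n : ℕ} (x : X.nonDegenerate n) :
    simplexChain X x.1 = Finsupp.single x 1 := by
  classical
  unfold simplexChain
  rw [dif_pos x.2]

/-- The faces of a degenerate simplex cancel each other in the normalized chains. -/
lemma sum_faces_degenerate {n : ℕ} {x : X _⦋n + 1⦌} (hx : x ∈ X.degenerate (n + 1)) :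
    ∑ i : Fin (n + 2), (-1 : ℤ) ^ (i : ℕ) • simplexChain X (X.δ i x) = 0 := by
  rw [SSet.degenerate_eq_iUnion_range_σ, Set.mem_iUnion] at hx
  obtain ⟨j, y, rfl⟩ := hx
  have key : ∀ i : Fin (n + 2), i ≠ j.castSucc → i ≠ j.succ →
      simplexChain X (X.δ i (X.σ j y)) = 0 := by
    intro i h1 h2
    apply simplexChain_of_degenerate
    obtain _ | n := n
    · exfalso
      fin_cases j
      fin_cases i <;> simp at h1 h2
    rcases lt_or_gt_of_ne h1 with h | h
    · obtain ⟨j, rfl⟩ := Fin.exists_succ_eq.2 (show j ≠ 0 by rintro rfl; simp at h)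
      obtain ⟨i, rfl⟩ := Fin.exists_castSucc_eq.2 (show i ≠ Fin.last _ by
        rintro rfl; exact absurd h (by simp [Fin.lt_def]; omega))
      rw [SSet.δ_comp_σ_of_le_apply (by
        rw [Fin.lt_def] at h; rw [Fin.le_def]
        simp at h ⊢; omega)]
      apply SSet.σ_mem_degenerate
    · rw [SSet.δ_comp_σ_of_gt'_apply (by
        rw [Fin.lt_def] at h ⊢
        have := Fin.val_ne_of_ne h2
        simp at h this ⊢; omega)]
      apply SSet.σ_mem_degenerate
  rw [← Finset.sum_subset (Finset.subset_univ {j.castSucc, j.succ}) (by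
    intro i _ hi
    simp only [Finset.mem_insert, Finset.mem_singleton, not_or] at hi
    rw [key i hi.1 hi.2, smul_zero]), Finset.sum_pair (by simp [Fin.ext_iff])]
  rw [SSet.δ_comp_σ_self_apply, SSet.δ_comp_σ_succ_apply]
  simp [pow_succ]

lemma normBd_simplexChain {n : ℕ} (x : X _⦋n + 1⦌) :
    normBd X n (simplexChain X x) =
      ∑ i : Fin (n + 2), (-1 : ℤ) ^ (i : ℕ) • simplexChain X (X.δ i x) := by
  by_cases hx : x ∈ X.nonDegenerate (n + 1)
  · rw [simplexChain_of_nonDegenerate X ⟨x, hx⟩]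
    simp [normBd]
  · have hx' : x ∈ X.degenerate (n + 1) := by simpa [SSet.nonDegenerate] using hx
    rw [simplexChain_of_degenerate X hx', map_zero, sum_faces_degenerate X hx']

lemma sum_sum_faces {A : Type*} [AddCommGroup A] {n : ℕ} (φ : X _⦋n⦌ → A) (x : X _⦋n + 2⦌) :
    ∑ i : Fin (n + 3), ∑ j : Fin (n + 2),
      (-1 : ℤ) ^ ((i : ℕ) + (j : ℕ)) • φ (X.δ j (X.δ i x)) = 0 := by
  rw [← Finset.sum_product']
  refine Finset.sum_involution (fun p _ =>
    if h : p.2.castSucc < p.1 then (p.2.castSucc, p.1.pred (Fin.ne_zero_of_lt h))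
    else (p.2.succ, p.1.castPred (by
      rintro h'; rw [h'] at h; exact h (Fin.castSucc_lt_last _)))) ?_ ?_ ?_ ?_
  · rintro ⟨i, j⟩ -
    by_cases h : j.castSucc < i
    · obtain ⟨i, rfl⟩ := Fin.exists_succ_eq.2 (Fin.ne_zero_of_lt h)
      simp only [h, dif_pos, Fin.pred_succ]
      rw [SSet.δ_comp_δ_apply (show j ≤ i by simpa using h)]
      rw [← add_smul]
      simp only [Fin.val_succ, Fin.val_castSucc]
      rw [show (-1 : ℤ) ^ ((i : ℕ) + 1 + j) + (-1) ^ ((j : ℕ) + i) = 0 by ring, zero_smul]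
    · obtain ⟨i, rfl⟩ := Fin.exists_castSucc_eq.2 (show i ≠ Fin.last _ by
        rintro rfl; exact h (Fin.castSucc_lt_last _))
      simp only [h, dif_neg, not_false_eq_true, Fin.castPred_castSucc]
      rw [← SSet.δ_comp_δ_apply (i := i) (j := j) (by simpa using h)]
      rw [← add_smul]
      simp only [Fin.val_succ, Fin.val_castSucc]
      rw [show (-1 : ℤ) ^ ((i : ℕ) + j) + (-1) ^ ((j : ℕ) + 1 + i) = 0 by ring, zero_smul]
  · rintro ⟨i, j⟩ - -
    dsimp only
    split_ifs with h
    · exact fun h' => absurd (congrArg Prod.fst h') h.ne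
    · intro h'
      have := congrArg Prod.fst h'
      simp only at this
      exact h (by rw [← this]; exact Fin.castSucc_lt_succ)
  · intros; simp
  · rintro ⟨i, j⟩ -
    by_cases h : j.castSucc < i
    · have h2 : ¬ (i.pred (Fin.ne_zero_of_lt h)).castSucc < j.castSucc := by
        simp only [Fin.lt_def, Fin.val_castSucc, Fin.val_pred] at h ⊢; omega
      simp [h, h2]
    · have h3 : i ≠ Fin.last _ := by rintro rfl; exact h (Fin.castSucc_lt_last _)
      have h2 : (i.castPred h3).castSucc < j.succ := by
        simp only [Fin.lt_def, Fin.val_castSucc, Fin.val_succ, Fin.castSucc_castPred] at h ⊢; omega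
      simp only [h, dif_neg, not_false_eq_true]
      rw [dif_pos h2]
      simp

lemma normBd_comp_normBd (n : ℕ) : normBd X n ∘ₗ normBd X (n + 1) = 0 := by
  have h : ∀ x, normBd X n (normBd X (n + 1) (Finsupp.single x 1)) = 0 := by
    intro x
    rw [← simplexChain_of_nonDegenerate X x, normBd_simplexChain]
    simp only [map_sum, map_zsmul, normBd_simplexChain]
    simp only [Finset.smul_sum, smul_smul, ← pow_add]
    exact sum_sum_faces X _ x.1
  refine Finsupp.lhom_ext' fun x => LinearMap.ext_ring ?_
  simpa using h x

/-- The normalized chain complex of a simplicial set, with the non-degenerate simplices as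
cells. -/
def normalizedComplex : CellComplex.{u} where
  cell n := X.nonDegenerate n
  bd := normBd X
  bd_comp_bd := normBd_comp_normBd X

end Normalized

/-! ### Twisted products -/

/-- A (left) action of a simplicial group on a simplicial set. -/
structure SimplicialAction (G : SimplicialObject GrpCat.{w}) (F : SSet.{u}) where
  smul : ∀ {n : SimplexCategoryᵒᵖ}, G.obj n → F.obj n → F.obj n
  one_smul : ∀ {n : SimplexCategoryᵒᵖ} (x : F.obj n), smul 1 x = x
  mul_smul : ∀ {n : SimplexCategoryᵒᵖ} (g g' : G.obj n) (x : F.obj n),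
    smul (g * g') x = smul g (smul g' x)
  map_smul : ∀ {n m : SimplexCategoryᵒᵖ} (α : n ⟶ m) (g : G.obj n) (x : F.obj n),
    F.map α (smul g x) = smul (G.map α g) (F.map α x)

/-- A twisting function `τ` from a simplicial set to a simplicial group. -/
structure TwistingFunction (G : SimplicialObject GrpCat.{w}) (B : SSet.{u}) where
  τ : ∀ n : ℕ, B _⦋n + 1⦌ → G _⦋n⦌
  δ_zero : ∀ n (b : B _⦋n + 2⦌),
    G.δ 0 (τ (n + 1) b) = (τ n (B.δ 0 b))⁻¹ * τ n (B.δ 1 b)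
  δ_succ : ∀ n (b : B _⦋n + 2⦌) (i : Fin (n + 1)),
    G.δ i.succ (τ (n + 1) b) = τ n (B.δ i.succ.succ b)
  σ_succ : ∀ n (b : B _⦋n + 1⦌) (i : Fin (n + 1)),
    G.σ i (τ n b) = τ (n + 1) (B.σ i.succ b)
  σ_zero : ∀ n (b : B _⦋n⦌), τ n (B.σ 0 b) = 1

section TwistedProduct

/-- For `α : [m] ⟶ [n]`, the map `[m + 1] ⟶ [n]` with `0 ↦ 0` and `i + 1 ↦ α i`. -/
def hat {m n : ℕ} (α : ⦋m⦌ ⟶ ⦋n⦌) : ⦋m + 1⦌ ⟶ ⦋n⦌ :=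
  SimplexCategory.Hom.mk
    ⟨Fin.cons 0 (fun i => α.toOrderHom i), by
      intro i j hij
      induction i using Fin.cases with
      | zero => simp
      | succ i =>
        induction j using Fin.cases with
        | zero => simp at hij
        | succ j => simpa using α.toOrderHom.monotone (by simpa using hij)⟩

/-- For `α : [m] ⟶ [n]`, the map `[m + 1] ⟶ [n + 1]` with `0 ↦ 0` and `i + 1 ↦ α i + 1`. -/
def shift {m n : ℕ} (α : ⦋m⦌ ⟶ ⦋n⦌) : ⦋m + 1⦌ ⟶ ⦋n + 1⦌ := hat (α ≫ SimplexCategory.δ 0)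

@[simp] lemma hat_zero {m n : ℕ} (α : ⦋m⦌ ⟶ ⦋n⦌) : (hat α).toOrderHom 0 = 0 := rfl

@[simp] lemma hat_succ {m n : ℕ} (α : ⦋m⦌ ⟶ ⦋n⦌) (i : Fin (m + 1)) :
    (hat α).toOrderHom i.succ = α.toOrderHom i := rfl

@[simp] lemma shift_zero {m n : ℕ} (α : ⦋m⦌ ⟶ ⦋n⦌) : (shift α).toOrderHom 0 = 0 := rfl

@[simp] lemma shift_succ {m n : ℕ} (α : ⦋m⦌ ⟶ ⦋n⦌) (i : Fin (m + 1)) :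
    (shift α).toOrderHom i.succ = (α.toOrderHom i).succ := rfl

lemma hom_ext_cases {m n : ℕ} {α β : ⦋m + 1⦌ ⟶ ⦋n⦌}
    (h0 : α.toOrderHom 0 = β.toOrderHom 0)
    (hs : ∀ i : Fin (m + 1), α.toOrderHom i.succ = β.toOrderHom i.succ) : α = β := by
  apply SimplexCategory.Hom.ext
  ext i : 2
  induction i using Fin.cases with
  | zero => exact h0
  | succ i => exact hs i

lemma hat_comp {k m n : ℕ} (β : ⦋k⦌ ⟶ ⦋m⦌) (α : ⦋m⦌ ⟶ ⦋n⦌) :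
    hat (β ≫ α) = shift β ≫ hat α :=
  hom_ext_cases rfl fun _ => rfl

lemma shift_comp {k m n : ℕ} (β : ⦋k⦌ ⟶ ⦋m⦌) (α : ⦋m⦌ ⟶ ⦋n⦌) :
    shift (β ≫ α) = shift β ≫ shift α :=
  hom_ext_cases rfl fun _ => rfl

lemma δ_comp_hat {m n : ℕ} (α : ⦋m⦌ ⟶ ⦋n⦌) : SimplexCategory.δ 0 ≫ hat α = α := by
  apply SimplexCategory.Hom.ext
  ext i : 2
  change (hat α).toOrderHom (Fin.succAbove 0 i) = _
  rw [Fin.zero_succAbove, hat_succ]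

lemma δ_comp_shift {m n : ℕ} (α : ⦋m⦌ ⟶ ⦋n⦌) :
    SimplexCategory.δ 0 ≫ shift α = α ≫ SimplexCategory.δ 0 := rfl

lemma hat_of_zero {m n : ℕ} (α : ⦋m⦌ ⟶ ⦋n⦌) (h : α.toOrderHom 0 = 0) :
    hat α = SimplexCategory.σ 0 ≫ α :=
  hom_ext_cases h.symm fun _ => rfl

lemma hat_δ_zero (n : ℕ) : hat (SimplexCategory.δ (0 : Fin (n + 2))) = 𝟙 _ :=
  hom_ext_cases rfl fun _ => rfl

lemma shift_δ {n : ℕ} (i : Fin (n + 2)) :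
    shift (SimplexCategory.δ i) = SimplexCategory.δ i.succ :=
  hom_ext_cases (by simp [SimplexCategory.δ]) fun j => by
    simp [SimplexCategory.δ]

lemma shift_σ {n : ℕ} (i : Fin (n + 1)) :
    shift (SimplexCategory.σ i) = SimplexCategory.σ i.succ :=
  hom_ext_cases (by simp [SimplexCategory.σ]) fun j => by
    simp [SimplexCategory.σ]

variable {G : SimplicialObject GrpCat.{w}} {B F : SSet.{u}}

lemma TwistingFunction.τ_hat_of_zero (t : TwistingFunction G B) {m n : ℕ} (α : ⦋m⦌ ⟶ ⦋n⦌)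
    (h : α.toOrderHom 0 = 0) (b : B _⦋n⦌) : t.τ m (B.map (hat α).op b) = 1 := by
  rw [hat_of_zero α h, op_comp, Functor.map_comp_apply]
  exact t.σ_zero _ _

/-- The cocycle relation satisfied by a twisting function. -/
lemma TwistingFunction.cocycle (t : TwistingFunction G B) {k m : ℕ} (β : ⦋k⦌ ⟶ ⦋m⦌)
    (c : B _⦋m + 1⦌) :
    t.τ k (B.map (shift β).op c) =
      t.τ k (B.map (hat β).op (B.δ 0 c)) * G.map β.op (t.τ m c) := by
  let W : MorphismProperty SimplexCategory := fun x y f =>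
    ∀ c : B _⦋y.len + 1⦌, t.τ x.len (B.map (shift (m := x.len) (n := y.len) f).op c) =
      t.τ x.len (B.map (hat (m := x.len) (n := y.len) f).op (B.δ 0 c)) *
        G.map f.op (t.τ y.len c)
  have : W.IsMultiplicative :=
    { id_mem := fun x c => by
        have h1 : shift (𝟙 ⦋x.len⦌) = 𝟙 _ := hom_ext_cases rfl fun _ => rfl
        change t.τ x.len (B.map (shift (𝟙 ⦋x.len⦌)).op c) =
          t.τ x.len (B.map (hat (𝟙 ⦋x.len⦌)).op (B.δ 0 c)) * G.map (𝟙 (op ⦋x.len⦌)) (t.τ x.len c)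
        rw [h1, t.τ_hat_of_zero _ rfl]
        simp
      comp_mem := fun {x y z} f g hf hg c => by
        change t.τ x.len (B.map (shift (m := x.len) (n := z.len) (f ≫ g)).op c) =
          t.τ x.len (B.map (hat (m := x.len) (n := z.len) (f ≫ g)).op (B.δ 0 c)) *
          G.map (g.op ≫ f.op) (t.τ z.len c)
        have e1 : shift (m := x.len) (n := z.len) (f ≫ g) =
          shift (m := x.len) (n := y.len) f ≫ shift (m := y.len) (n := z.len) g := shift_comp _ _
        have e2 : hat (m := x.len) (n := z.len) (f ≫ g) =
          shift (m := x.len) (n := y.len) f ≫ hat (m := y.len) (n := z.len) g := hat_comp _ _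
        have e3 : B.δ 0 (B.map (shift (m := y.len) (n := z.len) g).op c) =
            B.map g.op (B.δ 0 c) := by
          change B.map _ (B.map _ _) = B.map _ (B.map _ _)
          rw [← Functor.map_comp_apply, ← Functor.map_comp_apply]
          rfl
        have e4 : B.δ 0 (B.map (hat (m := y.len) (n := z.len) g).op (B.δ 0 c)) =
            B.map g.op (B.δ 0 c) := by
          change B.map _ (B.map _ _) = B.map _ (B.map _ _)
          rw [← Functor.map_comp_apply, ← op_comp, δ_comp_hat]
          rfl
        rw [e1, e2, op_comp, op_comp, Functor.map_comp_apply, Functor.map_comp_apply, hf, hf, hg,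
          e3, e4, map_mul, mul_assoc, Functor.map_comp_apply] }
  have hW : W = ⊤ := by
    refine SimplexCategory.morphismProperty_eq_top W ?_ ?_
    · intro n i c
      change t.τ n (B.map (shift (SimplexCategory.δ i)).op c) =
        t.τ n (B.map (hat (SimplexCategory.δ i)).op (B.δ 0 c)) * G.δ i (t.τ (n + 1) c)
      induction i using Fin.cases with
      | zero =>
        rw [hat_δ_zero, shift_δ, t.δ_zero]
        simp
        rfl
      | succ i =>
        rw [t.τ_hat_of_zero _ rfl, shift_δ, t.δ_succ, one_mul]
        rfl
    · intro n i c
      change t.τ (n + 1) (B.map (shift (SimplexCategory.σ i)).op c) =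
        t.τ (n + 1) (B.map (hat (SimplexCategory.σ i)).op (B.δ 0 c)) * G.σ i (t.τ n c)
      rw [t.τ_hat_of_zero _ (by simp [SimplexCategory.σ]), shift_σ, t.σ_succ, one_mul]
      rfl
  have h : W β := by rw [hW]; trivial
  exact h c

lemma TwistingFunction.τ_hat_comp (t : TwistingFunction G B) {k m n : ℕ} (β : ⦋k⦌ ⟶ ⦋m⦌)
    (α : ⦋m⦌ ⟶ ⦋n⦌) (b : B _⦋n⦌) :
    t.τ k (B.map (hat (β ≫ α)).op b) =
      t.τ k (B.map (hat β).op (B.map α.op b)) * G.map β.op (t.τ m (B.map (hat α).op b)) := by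
  have e : B.δ 0 (B.map (hat α).op b) = B.map α.op b := by
    change B.map _ (B.map _ _) = _
    rw [← Functor.map_comp_apply, ← op_comp, δ_comp_hat]
  rw [hat_comp, op_comp, Functor.map_comp_apply, t.cocycle, e]

/-- The twisted product `F ×_τ B`. It is the simplicial set with the simplices of `F × B`, whose
face operators are `∂₀ (f, b) = (τ(b) • ∂₀ f, ∂₀ b)` and `∂ᵢ (f, b) = (∂ᵢ f, ∂ᵢ b)` for `i > 0`,
and whose degeneracy operators are `ηᵢ (f, b) = (ηᵢ f, ηᵢ b)`, see `twistedProduct_δ_zero`,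
`twistedProduct_δ_succ` and `twistedProduct_σ` below. The operator of an arbitrary `α` is
`α^* (f, b) = (τ((hat α)^* b) • α^* f, α^* b)`. -/
def twistedProduct (act : SimplicialAction G F) (t : TwistingFunction G B) : SSet.{u} where
  obj n := F.obj n × B.obj n
  map {n m} α := ↾fun p =>
    (act.smul (n := m) (t.τ m.unop.len (B.map (hat (m := m.unop.len) (n := n.unop.len) α.unop).op p.2)) (F.map α p.1),
      B.map α p.2)
  map_id n := by
    apply ConcreteCategory.hom_ext
    intro p
    refine Prod.ext ?_ ?_
    · change act.smul (t.τ n.unop.len (B.map (hat (𝟙 ⦋n.unop.len⦌)).op p.2)) (F.map (𝟙 n) p.1) = p.1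
      rw [t.τ_hat_of_zero _ rfl]
      exact (act.one_smul _).trans (by simp)
    · change B.map (𝟙 n) p.2 = p.2
      simp
  map_comp {n m k} α β := by
    apply ConcreteCategory.hom_ext
    intro p
    refine Prod.ext ?_ ?_
    · change act.smul (t.τ k.unop.len
          (B.map (hat (m := k.unop.len) (n := n.unop.len) (β.unop ≫ α.unop)).op p.2))
          (F.map (α ≫ β) p.1) =
        act.smul (t.τ k.unop.len
          (B.map (hat (m := k.unop.len) (n := m.unop.len) β.unop).op (B.map α p.2)))
          (F.map β (act.smul (t.τ m.unop.len
            (B.map (hat (m := m.unop.len) (n := n.unop.len) α.unop).op p.2)) (F.map α p.1)))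
      rw [act.map_smul, ← act.mul_smul, Functor.map_comp_apply]
      congr 1
      exact t.τ_hat_comp (k := k.unop.len) (m := m.unop.len) (n := n.unop.len) β.unop α.unop p.2
    · change B.map (α ≫ β) p.2 = B.map β (B.map α p.2)
      simp

variable (act : SimplicialAction G F) (t : TwistingFunction G B)

lemma twistedProduct_δ_zero {n : ℕ} (x : F _⦋n + 1⦌) (b : B _⦋n + 1⦌) :
    (twistedProduct act t).δ 0 (x, b) = (act.smul (t.τ n b) (F.δ 0 x), B.δ 0 b) := by
  change (act.smul (t.τ n (B.map (hat (SimplexCategory.δ 0)).op b)) (F.δ 0 x), B.δ 0 b) = _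
  rw [hat_δ_zero]
  simp

lemma twistedProduct_δ_succ {n : ℕ} (i : Fin (n + 1)) (x : F _⦋n + 1⦌) (b : B _⦋n + 1⦌) :
    (twistedProduct act t).δ i.succ (x, b) = (F.δ i.succ x, B.δ i.succ b) := by
  change (act.smul (t.τ n (B.map (hat (SimplexCategory.δ i.succ)).op b)) (F.δ i.succ x),
    B.δ i.succ b) = _
  rw [t.τ_hat_of_zero _ rfl, act.one_smul]

lemma twistedProduct_σ {n : ℕ} (i : Fin (n + 1)) (x : F _⦋n⦌) (b : B _⦋n⦌) :
    (twistedProduct act t).σ i (x, b) = (F.σ i x, B.σ i b) := by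
  change (act.smul (t.τ (n + 1) (B.map (hat (SimplexCategory.σ i)).op b)) (F.σ i x),
    B.σ i b) = _
  rw [t.τ_hat_of_zero _ (by simp [SimplexCategory.σ]), act.one_smul]

/-- The twisted and the untwisted product have the same non-degenerate simplices. -/
lemma mem_nonDegenerate_twistedProduct_iff {n : ℕ} (p : F _⦋n⦌ × B _⦋n⦌) :
    p ∈ (twistedProduct act t).nonDegenerate n ↔ p ∈ (F ⊗ B).nonDegenerate n := by
  obtain _ | n := n
  · rw [SSet.nondegenerate_zero, SSet.nondegenerate_zero]
    exact iff_of_true (Set.mem_univ _) (Set.mem_univ _)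
  · have key : (twistedProduct act t).degenerate (n + 1) = (F ⊗ B).degenerate (n + 1) := by
      rw [SSet.degenerate_eq_iUnion_range_σ, SSet.degenerate_eq_iUnion_range_σ]
      refine Set.iUnion_congr fun i => congrArg Set.range ?_
      exact funext fun y => twistedProduct_σ act t i y.1 y.2
    exact not_congr (iff_of_eq (congrArg (fun S : Set (F _⦋n + 1⦌ × B _⦋n + 1⦌) => p ∈ S) key))

end TwistedProduct

/-! ### Simplices of a product as s-paths -/

section SPaths

/-- The dimension `p` of the non-degenerate simplex in the canonical expression `x = η^* x'` of a
simplex, where `η` is a surjection `[n] ⟶ [p]` and `x'` is a non-degenerate `p`-simplex. -/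
def geomDim {X : SSet.{u}} {n : ℕ} (x : X _⦋n⦌) : ℕ := (X.exists_nonDegenerate x).choose

/-- The surjection `η : [n] ⟶ [p]` in the canonical expression `x = η^* x'` of a simplex. -/
def degMap {X : SSet.{u}} {n : ℕ} (x : X _⦋n⦌) : ⦋n⦌ ⟶ ⦋geomDim x⦌ :=
  (X.exists_nonDegenerate x).choose_spec.choose

variable {X Y : SSet.{u}}

/-- The bidimension of a simplex of `X × Y`. -/
def bidim {n : ℕ} (r : (X ⊗ Y : SSet.{u}) _⦋n⦌) : ℕ × ℕ := (geomDim r.1, geomDim r.2)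

/-- The s-path of a simplex `(η^* x', θ^* y')` of `X × Y`, in canonical form: the sequence of the
points `(η k, θ k)` of the lattice `[p] × [q]`, where `(p, q)` is the bidimension. -/
def sPath {n : ℕ} (r : (X ⊗ Y : SSet.{u}) _⦋n⦌) (k : Fin (n + 1)) : ℕ × ℕ :=
  ((degMap r.1).toOrderHom k, (degMap r.2).toOrderHom k)

variable {n : ℕ} (π : Fin (n + 1) → ℕ × ℕ)

def IsVertical (i : Fin n) : Prop := π i.succ = π i.castSucc + (0, 1)

def IsHorizontal (i : Fin n) : Prop := π i.succ = π i.castSucc + (1, 0)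

def IsDiagonal (i : Fin n) : Prop := π i.succ = π i.castSucc + (1, 1)

/-- The path has a `+90°` bend (when it is run backward) at the vertex `j = i + 1`: the step `i`
before this vertex is vertical and the step `j` after it is horizontal. -/
def IsBend (i j : Fin n) : Prop := (i : ℕ) + 1 = j ∧ IsVertical π i ∧ IsHorizontal π j

/-- When the path is run backward from its end to the vertex `k`, neither a diagonal step nor a
`+90°` bend is met. -/
def EventFreeFrom (k : ℕ) : Prop :=
  ∀ i : Fin n, k ≤ i → ¬ IsDiagonal π i ∧ ∀ j, ¬ IsBend π i j

/-- Run backward, the first event is a diagonal step. -/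
def IsSourcePath : Prop := ∃ i, IsDiagonal π i ∧ EventFreeFrom π (i + 1)

/-- Run backward, the first event is a `+90°` bend. -/
def IsTargetPath : Prop := ∃ i j, IsBend π i j ∧ EventFreeFrom π j

/-- No event occurs. -/
def IsCriticalPath : Prop := EventFreeFrom π 0

/-- The number of points of the lattice `[p] × [q]` strictly above the s-path of a simplex of
bidimension `(p, q)`. -/
def pointsAbove (r : (X ⊗ Y : SSet.{u}) _⦋n⦌) : ℕ := by
  classical exact
  ((Finset.range ((bidim r).1 + 1) ×ˢ Finset.range ((bidim r).2 + 1)).filter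
    (fun ab => ∀ k, (sPath r k).1 = ab.1 → (sPath r k).2 < ab.2)).card

end SPaths

/-! ### The Eilenberg-Zilber vector field -/

/-- The Eilenberg-Zilber vector field of `X × Y`: the pairs `(s, t)` of non-degenerate simplices
where the first event of `t` is a `+90°` bend and `s` is the face of `t` obtained by skipping the
vertex of this bend. -/
def ezField (X Y : SSet.{u}) : PairFamily (normalizedComplex (X ⊗ Y)) := fun n s t =>
  ∃ i j : Fin (n + 1), IsBend (sPath t.1) i j ∧ EventFreeFrom (sPath t.1) j ∧
    s.1 = (X ⊗ Y : SSet.{u}).δ j.castSucc t.1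

section

variable {G : SimplicialObject GrpCat.{w}} {F B : SSet.{u}}
  (act : SimplicialAction G F) (t : TwistingFunction G B)

/-- A non-degenerate simplex of `F ×_τ B`, seen as a non-degenerate simplex of `F × B`. -/
def untwist {n : ℕ} (c : (normalizedComplex (twistedProduct act t)).cell n) :
    (normalizedComplex (F ⊗ B)).cell n :=
  ⟨c.1, (mem_nonDegenerate_twistedProduct_iff act t c.1).1 c.2⟩

/-- The Eilenberg-Zilber vector field of `F × B`, seen as a collection of pairs of cells of
`F ×_τ B`. -/
def twistedEZField : PairFamily (normalizedComplex (twistedProduct act t)) := fun n s s' =>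
  ezField F B n (untwist act t s) (untwist act t s')

end

/-- The surjection `[p + q] ⟶ [p]`, `k ↦ min k p`. -/
def lastLeft (p q : ℕ) : ⦋p + q⦌ ⟶ ⦋p⦌ :=
  SimplexCategory.Hom.mk ⟨fun k => ⟨min k p, Nat.lt_succ_of_le (min_le_right _ _)⟩, fun i j h => by
    simp only [Fin.le_def] at h ⊢; omega⟩

/-- The surjection `[p + q] ⟶ [q]`, `k ↦ max 0 (k - p)`. -/
def lastRight (p q : ℕ) : ⦋p + q⦌ ⟶ ⦋q⦌ :=
  SimplexCategory.Hom.mk ⟨fun k => ⟨(k : ℕ) - p, by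
    have h : (k : ℕ) < p + q + 1 := k.isLt
    change (k : ℕ) - p < q + 1
    omega⟩, fun i j h => by
    simp only [Fin.le_def] at h ⊢; omega⟩

/-- The last simplex of the prism `x × y`, with the s-path
`(0, 0), (1, 0), …, (p, 0), (p, 1), …, (p, q)`. -/
def lastSimplex {X Y : SSet.{u}} {p q : ℕ} (x : X _⦋p⦌) (y : Y _⦋q⦌) :
    X _⦋p + q⦌ × Y _⦋p + q⦌ :=
  (X.map (lastLeft p q).op x, Y.map (lastRight p q).op y)

/-! ### The underlying graded module of the tensor product -/

section

variable (X Y : SSet.{u})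

/-- The component of degree `n` of the tensor product of the normalized chain complexes of `X` and
`Y`. -/
abbrev TensorModule (n : ℕ) : Type u :=
  ⨁ pq : Finset.HasAntidiagonal.antidiagonal n, (X.nonDegenerate pq.1.1 →₀ ℤ) ⊗[ℤ] (Y.nonDegenerate pq.1.2 →₀ ℤ)

/-- The generator `x ⊗ y`. -/
def tensorGen {X Y : SSet.{u}} {p q : ℕ} (x : X.nonDegenerate p) (y : Y.nonDegenerate q) :
    TensorModule X Y (p + q) :=
  DirectSum.lof ℤ (Finset.HasAntidiagonal.antidiagonal (p + q))
    (fun pq => (X.nonDegenerate pq.1.1 →₀ ℤ) ⊗[ℤ] (Y.nonDegenerate pq.1.2 →₀ ℤ))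
    ⟨(p, q), Finset.HasAntidiagonal.mem_antidiagonal.2 rfl⟩ (Finsupp.single x 1 ⊗ₜ[ℤ] Finsupp.single y 1)

/-- The chain complex with the same underlying graded module as the tensor product of the
normalized chain complexes of `X` and `Y`, and with the differential `d`. -/
abbrev twistedTensor (d : ∀ n, TensorModule X Y (n + 1) →ₗ[ℤ] TensorModule X Y n)
    (hd : ∀ n, d n ∘ₗ d (n + 1) = 0) : ChainComplex (ModuleCat.{u} ℤ) ℕ :=
  ChainComplex.of (fun n => ModuleCat.of ℤ (TensorModule X Y n)) (fun n => ModuleCat.ofHom (d n))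
    (fun n => by rw [← ModuleCat.ofHom_comp, hd]; rfl)

end

end TwistedEZ

end

open TwistedEZ

/-!
A vector field `V` identifies the sources with the targets, up to the signs of the incidence
numbers. This turns `d₂₁` into `1 - N`, where `N` moves every cell one step further along the paths
of `V`; if these terminate, then `N` is locally nilpotent and `d₂₁` is invertible. The homotopy
`h = d₂₁⁻¹` satisfies `hh = 0` and `hdh = h`, so `1 - dh - hd` is a projector commuting with `d`,
and its image is isomorphic to the critical part.

Twisting changes the face `∂₀` only, and, as `τ(η₀ b) = 1`, only where `∂₀` lowers the dimension of
the base, that is, the first component of `(q, p, L)`. The pairs of `V` avoid `∂₀`, so both `V` and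
its Lyapunov function are those of the untwisted product.
-/

noncomputable section

namespace TwistedEZ

/-! ### Locally nilpotent perturbations of the identity -/

section LocallyNilpotent

variable {R : Type*} [CommRing R]

lemma mem_maxGenEigenspace_zero_iff {M : Type*} [AddCommGroup M] [Module R M]
    {N : Module.End R M} {x : M} : x ∈ N.maxGenEigenspace 0 ↔ ∃ k : ℕ, (N ^ k) x = 0 := by
  simp [Module.End.mem_maxGenEigenspace]

lemma isUnit_one_sub_of_maxGenEigenspace_eq_top {M : Type*} [AddCommGroup M] [Module R M]
    {N : Module.End R M} (hN : N.maxGenEigenspace 0 = ⊤) : IsUnit (1 - N) := by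
  have exists_pow_apply_eq_zero (x : M) : ∃ k : ℕ, (N ^ k) x = 0 :=
    mem_maxGenEigenspace_zero_iff.1 (hN ▸ Submodule.mem_top)
  refine (Module.End.isUnit_iff _).2 ⟨(injective_iff_map_eq_zero _).2 fun x hx => ?_, fun y => ?_⟩
  · obtain ⟨k, hk⟩ := exists_pow_apply_eq_zero x
    have hfix : Function.IsFixedPt N x := (sub_eq_zero.1 hx).symm
    rw [← hk, Module.End.pow_apply, hfix.iterate k]
  · obtain ⟨k, hk⟩ := exists_pow_apply_eq_zero y
    refine ⟨(∑ i ∈ Finset.range k, N ^ i) y, ?_⟩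
    rw [← Module.End.mul_apply, mul_neg_geom_sum, LinearMap.sub_apply, hk, sub_zero,
      Module.End.one_apply]

lemma maxGenEigenspace_eq_top_of_wellFounded {α : Type*} {r : α → α → Prop} (hr : WellFounded r)
    {N : Module.End R (α →₀ R)}
    (hN : ∀ a, N (Finsupp.single a 1) ∈ Finsupp.supported R R {b | r b a}) :
    N.maxGenEigenspace 0 = ⊤ := by
  have mem_of_apply_mem {x : α →₀ R} (hx : N x ∈ N.maxGenEigenspace 0) :
      x ∈ N.maxGenEigenspace 0 := by
    rw [mem_maxGenEigenspace_zero_iff] at hx ⊢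
    obtain ⟨k, hk⟩ := hx
    exact ⟨k + 1, by rw [pow_succ, Module.End.mul_apply, hk]⟩
  have single_mem (a : α) : Finsupp.single a 1 ∈ N.maxGenEigenspace 0 := by
    induction a using hr.induction with
    | _ a ih =>
      refine mem_of_apply_mem (SetLike.le_def.1 ?_ (hN a))
      rw [Finsupp.supported_eq_span_single, Submodule.span_le]
      rintro _ ⟨b, hb, rfl⟩
      exact ih b hb
  refine eq_top_iff.2 fun x _ => ?_
  induction x using Finsupp.induction_linear with
  | zero => exact Submodule.zero_mem _
  | add x y hx hy => exact Submodule.add_mem _ (hx trivial) (hy trivial)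
  | single a c => exact Finsupp.smul_single_one a c ▸ Submodule.smul_mem _ c (single_mem a)

end LocallyNilpotent

/-! ### Components of chains -/

section Component

variable {C : CellComplex.{u}} {n : ℕ} {P Q : C.cell n → Prop} {x : C.cell n →₀ ℤ}

open Classical in
lemma component_eq_filter (P : C.cell n → Prop) (x : C.cell n →₀ ℤ) :
    component P x = x.filter P := by
  induction x using Finsupp.induction_linear with
  | zero => rw [map_zero, Finsupp.filter_zero]
  | add x y hx hy => rw [map_add, hx, hy, Finsupp.filter_add]
  | single c a => by_cases hc : P c <;> simp [component, hc]

lemma component_apply_of_pos {c : C.cell n} (hc : P c) (x : C.cell n →₀ ℤ) :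
    component P x c = x c := by
  classical rw [component_eq_filter, Finsupp.filter_apply_pos P x hc]

lemma component_apply_of_neg {c : C.cell n} (hc : ¬ P c) (x : C.cell n →₀ ℤ) :
    component P x c = 0 := by
  classical rw [component_eq_filter, Finsupp.filter_apply_neg P x hc]

lemma mem_spanOf_iff : x ∈ spanOf P ↔ ∀ c, ¬ P c → x c = 0 :=
  Finsupp.mem_supported' ℤ x

lemma single_mem_spanOf {c : C.cell n} (hc : P c) (a : ℤ) : Finsupp.single c a ∈ spanOf P :=
  Finsupp.single_mem_supported ℤ a hc

lemma component_mem (P : C.cell n → Prop) (x : C.cell n →₀ ℤ) : component P x ∈ spanOf P :=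
  mem_spanOf_iff.2 fun _ hc => component_apply_of_neg hc x

lemma component_eq_self_iff : component P x = x ↔ x ∈ spanOf P := by
  refine ⟨fun h => h ▸ component_mem P x, fun hx => Finsupp.ext fun c => ?_⟩
  by_cases hc : P c
  · exact component_apply_of_pos hc x
  · rw [component_apply_of_neg hc, mem_spanOf_iff.1 hx c hc]

lemma component_eq_zero_of_disjoint (h : ∀ c, P c → ¬ Q c) (hx : x ∈ spanOf P) :
    component Q x = 0 := by
  refine Finsupp.ext fun c => ?_
  by_cases hc : Q c
  · rw [component_apply_of_pos hc, mem_spanOf_iff.1 hx c fun hP => h c hP hc, Finsupp.zero_apply]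
  · exact component_apply_of_neg hc x

end Component

/-! ### Discrete vector fields -/

section VectorFields

variable {C : CellComplex.{u}} {V : PairFamily C}

variable (V) in
/-- The step relation of `V`-paths, between the sources of two consecutive vectors. -/
def pathRel (n : ℕ) (s' s : C.cell n) : Prop :=
  ∃ t, V n s t ∧ IsFace C s' t ∧ s' ≠ s ∧ IsSource V s'

lemma IsLyapunov.wellFounded_pathRel {α : Type*} [LT α] [WellFoundedLT α]
    {L : ∀ n, C.cell n → α} (hL : IsLyapunov V L) (n : ℕ) : WellFounded (pathRel V n) := by
  refine Subrelation.wf (r := InvImage (· < ·) (L n)) ?_ (InvImage.wf _ wellFounded_lt)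
  rintro s' s ⟨t, hst, hf, hne, t', hs't'⟩
  exact hL n s s' t t' hst hs't' hf hne

lemma finite_setOf_isFace {n : ℕ} (t : C.cell (n + 1)) : {s | IsFace C s t}.Finite :=
  (C.bd n (Finsupp.single t 1)).hasFiniteSupport

lemma isVPath_cons_cons_iff {n : ℕ} {v v' : C.cell n × C.cell (n + 1)}
    {l : List (C.cell n × C.cell (n + 1))} :
    IsVPath V n (v :: v' :: l) ↔
      V n v.1 v.2 ∧ (IsFace C v'.1 v.2 ∧ v'.1 ≠ v.1) ∧ IsVPath V n (v' :: l) := by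
  simp only [IsVPath, List.forall_mem_cons, List.isChain_cons_cons]
  tauto

lemma IsDiscreteVectorField.isAdmissible (hV : IsDiscreteVectorField V)
    (hwf : ∀ n, WellFounded (pathRel V n)) : IsAdmissible V := by
  have exists_bound (n : ℕ) (s : C.cell n) : ∃ N : ℕ, ∀ t l, IsVPath V n ((s, t) :: l) →
      ((s, t) :: l).length ≤ N := by
    induction s using (hwf n).induction with
    | _ s ih =>
      by_cases hs : IsSource V s
      · obtain ⟨t, hst⟩ := hs
        choose! N hN using ih
        obtain ⟨M, hM⟩ := ((finite_setOf_isFace t).image N).bddAbove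
        refine ⟨M + 1, fun t' l hl => ?_⟩
        obtain rfl : t = t' := hV.target_unique hst (hl.1 (s, t') List.mem_cons_self)
        obtain _ | ⟨⟨s', t'⟩, l⟩ := l
        · simp
        · obtain ⟨-, ⟨hface, hne⟩, hl'⟩ := isVPath_cons_cons_iff.1 hl
          have hs't' : V n s' t' := hl'.1 (s', t') List.mem_cons_self
          have hlen := hN s' ⟨t, hst, hface, hne, t', hs't'⟩ t' l hl'
          have hNM : N s' ≤ M := hM (Set.mem_image_of_mem N hface)
          simp only [List.length_cons] at hlen ⊢
          omega
      · exact ⟨0, fun t l hl => absurd ⟨t, hl.1 (s, t) List.mem_cons_self⟩ hs⟩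
  choose N hN using exists_bound
  exact ⟨N, fun n v l hl => hN n v.1 v.2 l hl⟩

lemma IsDiscreteVectorField.not_isTarget_of_isSource (hV : IsDiscreteVectorField V) {n : ℕ}
    {c : C.cell n} (hs : IsSource V c) : ¬ IsTarget V c := by
  obtain _ | n := n
  · exact fun h => h
  · rintro ⟨s, hs'⟩
    obtain ⟨t, ht⟩ := hs
    exact hV.not_source_of_target hs' ht

lemma IsDiscreteVectorField.incidence_mul_self (hV : IsDiscreteVectorField V) {n : ℕ}
    {s : C.cell n} {t : C.cell (n + 1)} (h : V n s t) : incidence C s t * incidence C s t = 1 := by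
  rcases hV.regular h with h | h <;> simp [h]

lemma IsDiscreteVectorField.component_target_add_source_add_critical
    (hV : IsDiscreteVectorField V) {n : ℕ} (x : C.cell n →₀ ℤ) :
    component (IsTarget V) x + component (IsSource V) x + component (IsCritical V) x = x := by
  refine Finsupp.ext fun c => ?_
  simp only [Finsupp.add_apply]
  by_cases hs : IsSource V c
  · rw [component_apply_of_neg (hV.not_isTarget_of_isSource hs), component_apply_of_pos hs,
      component_apply_of_neg fun hc => hc.1 hs, zero_add, add_zero]
  · rw [component_apply_of_neg hs, add_zero]
    by_cases ht : IsTarget V c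
    · rw [component_apply_of_pos ht, component_apply_of_neg fun hc => hc.2 ht, add_zero]
    · rw [component_apply_of_neg ht, component_apply_of_pos ⟨hs, ht⟩, zero_add]

end VectorFields

/-! ### Gauss elimination -/

section Gauss

variable {C : CellComplex.{u}} (V : PairFamily C)

open Classical in
/-- The map sending each source cell to the target cell of its vector, with the sign which makes
the coefficient of the cell in the boundary of its image equal to `1`, and all other cells to
zero. -/
def vectorMap (n : ℕ) : (C.cell n →₀ ℤ) →ₗ[ℤ] (C.cell (n + 1) →₀ ℤ) :=
  Finsupp.linearCombination ℤ fun s =>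
    if h : IsSource V s then Finsupp.single h.choose (incidence C s h.choose) else 0

/-- The sum over the one-step continuations of `V`-paths: the source component of `1 - d v`, where
`v` is `vectorMap`. -/
def pathMap (n : ℕ) : Module.End ℤ (C.cell n →₀ ℤ) :=
  component (IsSource V) ∘ₗ (LinearMap.id - C.bd n ∘ₗ vectorMap V n)

/-- The homotopy operator defined by a vector field: the inverse of the component of the
differential from target chains to source chains. Without infinite `V`-paths `1 - pathMap V n` is
invertible, whereas otherwise `Ring.inverse` may be zero. -/
def gaussMap (n : ℕ) : (C.cell n →₀ ℤ) →ₗ[ℤ] (C.cell (n + 1) →₀ ℤ) :=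
  vectorMap V n ∘ₗ Ring.inverse (1 - pathMap V n)

variable {V}

lemma vectorMap_of_not_isSource {n : ℕ} {c : C.cell n} (hc : ¬ IsSource V c) :
    vectorMap V n (Finsupp.single c 1) = 0 := by
  simp [vectorMap, hc]

lemma IsDiscreteVectorField.vectorMap_single (hV : IsDiscreteVectorField V) {n : ℕ}
    {s : C.cell n} {t : C.cell (n + 1)} (h : V n s t) :
    vectorMap V n (Finsupp.single s 1) = incidence C s t • Finsupp.single t 1 := by
  have hs : IsSource V s := ⟨t, h⟩
  obtain rfl : t = hs.choose := hV.target_unique h hs.choose_spec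
  simp [vectorMap, hs]

lemma IsDiscreteVectorField.exists_vectorMap_eq_single (hV : IsDiscreteVectorField V) {n : ℕ}
    {t : C.cell (n + 1)} (ht : IsTarget V t) : ∃ x, vectorMap V n x = Finsupp.single t 1 := by
  obtain ⟨s, hst⟩ := ht
  refine ⟨incidence C s t • Finsupp.single s 1, ?_⟩
  rw [map_zsmul, hV.vectorMap_single hst, smul_smul, hV.incidence_mul_self hst, one_smul]

lemma vectorMap_mem (n : ℕ) (x : C.cell n →₀ ℤ) :
    vectorMap V n x ∈ spanOf (fun t : C.cell (n + 1) => IsTarget V t) := by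
  rw [vectorMap, Finsupp.linearCombination_apply]
  refine Submodule.sum_mem _ fun s _ => Submodule.smul_mem _ _ ?_
  split_ifs with h
  · exact single_mem_spanOf ⟨s, h.choose_spec⟩ _
  · exact Submodule.zero_mem _

lemma pathMap_apply (n : ℕ) (x : C.cell n →₀ ℤ) :
    pathMap V n x = component (IsSource V) (x - C.bd n (vectorMap V n x)) := rfl

lemma pathMap_of_not_isSource {n : ℕ} {c : C.cell n} (hc : ¬ IsSource V c) :
    pathMap V n (Finsupp.single c 1) = 0 := by
  rw [pathMap_apply, vectorMap_of_not_isSource hc, map_zero, sub_zero]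
  exact component_eq_zero_of_disjoint (P := fun c => ¬ IsSource V c) (fun _ h => h)
    (single_mem_spanOf hc 1)

lemma component_source_bd_vectorMap (n : ℕ) (x : C.cell n →₀ ℤ) :
    component (IsSource V) (C.bd n (vectorMap V n x)) =
      component (IsSource V) ((1 - pathMap V n) x) := by
  rw [LinearMap.sub_apply, Module.End.one_apply, map_sub, pathMap_apply,
    component_eq_self_iff.2 (component_mem _ _), map_sub, sub_sub_cancel]

lemma IsDiscreteVectorField.pathMap_single_mem (hV : IsDiscreteVectorField V) {n : ℕ}
    (s : C.cell n) :
    pathMap V n (Finsupp.single s 1) ∈ spanOf (fun s' : C.cell n => pathRel V n s' s) := by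
  by_cases hs : IsSource V s
  · obtain ⟨t, hst⟩ := hs
    refine mem_spanOf_iff.2 fun s' hs' => ?_
    rw [pathMap_apply]
    by_cases hsrc : IsSource V s'
    · rw [component_apply_of_pos hsrc, hV.vectorMap_single hst, map_zsmul]
      change Finsupp.single s 1 s' - incidence C s t * incidence C s' t = 0
      by_cases heq : s' = s
      · rw [heq, Finsupp.single_eq_same, hV.incidence_mul_self hst, sub_self]
      · have hface : ¬ IsFace C s' t := fun hface => hs' ⟨t, hst, hface, heq, hsrc⟩
        rw [Finsupp.single_eq_of_ne heq, not_not.1 hface, mul_zero, sub_zero]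
    · exact component_apply_of_neg hsrc _
  · rw [pathMap_of_not_isSource hs]
    exact Submodule.zero_mem _

lemma IsDiscreteVectorField.isUnit_one_sub_pathMap (hV : IsDiscreteVectorField V) {n : ℕ}
    (hwf : WellFounded (pathRel V n)) : IsUnit (1 - pathMap V n) :=
  isUnit_one_sub_of_maxGenEigenspace_eq_top <|
    maxGenEigenspace_eq_top_of_wellFounded hwf hV.pathMap_single_mem

lemma gaussMap_mem (n : ℕ) (x : C.cell n →₀ ℤ) :
    gaussMap V n x ∈ spanOf (fun t : C.cell (n + 1) => IsTarget V t) :=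
  vectorMap_mem n _

lemma component_critical_gaussMap (n : ℕ) (x : C.cell n →₀ ℤ) :
    component (IsCritical V) (gaussMap V n x) = 0 :=
  component_eq_zero_of_disjoint (fun _ ht hc => hc.2 ht) (gaussMap_mem n x)

section

variable {n : ℕ} (hV : IsDiscreteVectorField V) (hwf : WellFounded (pathRel V n))

include hV hwf

lemma gaussMap_one_sub_pathMap (x : C.cell n →₀ ℤ) :
    gaussMap V n ((1 - pathMap V n) x) = vectorMap V n x := by
  rw [gaussMap, LinearMap.comp_apply, ← Module.End.mul_apply,
    Ring.inverse_mul_cancel _ (hV.isUnit_one_sub_pathMap hwf), Module.End.one_apply]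

lemma component_source_bd_gaussMap (x : C.cell n →₀ ℤ) :
    component (IsSource V) (C.bd n (gaussMap V n x)) = component (IsSource V) x := by
  rw [gaussMap, LinearMap.comp_apply, component_source_bd_vectorMap,
    ← Module.End.mul_apply (1 - pathMap V n),
    Ring.mul_inverse_cancel _ (hV.isUnit_one_sub_pathMap hwf), Module.End.one_apply]

lemma gaussMap_single_of_not_isSource {c : C.cell n} (hc : ¬ IsSource V c) :
    gaussMap V n (Finsupp.single c 1) = 0 := by
  have h := gaussMap_one_sub_pathMap hV hwf (Finsupp.single c 1)
  rwa [vectorMap_of_not_isSource hc, LinearMap.sub_apply, pathMap_of_not_isSource hc,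
    Module.End.one_apply, sub_zero] at h

lemma gaussMap_component_source (x : C.cell n →₀ ℤ) :
    gaussMap V n (component (IsSource V) x) = gaussMap V n x := by
  suffices h : gaussMap V n ∘ₗ component (IsSource V) = gaussMap V n from LinearMap.congr_fun h x
  refine Finsupp.lhom_ext' fun c => LinearMap.ext_ring ?_
  change gaussMap V n (component (IsSource V) (Finsupp.single c 1)) =
    gaussMap V n (Finsupp.single c 1)
  by_cases hc : IsSource V c
  · rw [component_eq_self_iff.2 (single_mem_spanOf hc 1)]
  · rw [gaussMap_single_of_not_isSource hV hwf hc, component_eq_zero_of_disjoint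
      (P := fun c => ¬ IsSource V c) (fun _ h => h) (single_mem_spanOf hc 1), map_zero]

lemma gaussMap_eq_zero {P : C.cell n → Prop} (hP : ∀ c, P c → ¬ IsSource V c)
    {x : C.cell n →₀ ℤ} (hx : x ∈ spanOf P) : gaussMap V n x = 0 := by
  rw [← gaussMap_component_source hV hwf, component_eq_zero_of_disjoint hP hx, map_zero]

lemma gaussMap_bd_vectorMap (x : C.cell n →₀ ℤ) :
    gaussMap V n (C.bd n (vectorMap V n x)) = vectorMap V n x := by
  rw [← gaussMap_component_source hV hwf, component_source_bd_vectorMap,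
    gaussMap_component_source hV hwf, gaussMap_one_sub_pathMap hV hwf]

lemma gaussMap_bd_gaussMap (x : C.cell n →₀ ℤ) :
    gaussMap V n (C.bd n (gaussMap V n x)) = gaussMap V n x :=
  gaussMap_bd_vectorMap hV hwf _

lemma gaussMap_bd_of_isTarget {x : C.cell (n + 1) →₀ ℤ}
    (hx : x ∈ spanOf (fun t : C.cell (n + 1) => IsTarget V t)) :
    gaussMap V n (C.bd n x) = x := by
  rw [spanOf, Finsupp.supported_eq_span_single] at hx
  refine LinearMap.eqOn_span (f := gaussMap V n ∘ₗ C.bd n) (g := LinearMap.id) ?_ hx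
  rintro _ ⟨t, ht, rfl⟩
  obtain ⟨y, hy⟩ := hV.exists_vectorMap_eq_single ht
  change gaussMap V n (C.bd n (Finsupp.single t 1)) = Finsupp.single t 1
  rw [← hy, gaussMap_bd_vectorMap hV hwf]

end

lemma gaussMap_gaussMap (hV : IsDiscreteVectorField V) {n : ℕ}
    (hwf : WellFounded (pathRel V (n + 1))) (x : C.cell n →₀ ℤ) :
    gaussMap V (n + 1) (gaussMap V n x) = 0 :=
  gaussMap_eq_zero hV hwf (fun _ ht hs => hV.not_isTarget_of_isSource hs ht) (gaussMap_mem n x)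

section Reduction

variable (V) in
/-- The composite `h d` in degree `n`, where `h` is `gaussMap`; it is zero in degree `0`. -/
def gaussMapBd (n : ℕ) : (C.cell n →₀ ℤ) →ₗ[ℤ] (C.cell n →₀ ℤ) :=
  match n with
  | 0 => 0
  | n + 1 => gaussMap V n ∘ₗ C.bd n

lemma CellComplex.bd_bd (n : ℕ) (x : C.cell (n + 2) →₀ ℤ) : C.bd n (C.bd (n + 1) x) = 0 :=
  LinearMap.congr_fun (C.bd_comp_bd n) x

lemma gaussMapBd_bd (n : ℕ) (x : C.cell (n + 1) →₀ ℤ) : gaussMapBd V n (C.bd n x) = 0 := by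
  obtain _ | n := n
  · rfl
  · change gaussMap V n (C.bd n (C.bd (n + 1) x)) = 0
    rw [C.bd_bd, map_zero]

lemma gaussMapBd_mem (n : ℕ) (x : C.cell n →₀ ℤ) :
    gaussMapBd V n x ∈ spanOf (fun t : C.cell n => IsTarget V t) := by
  obtain _ | n := n
  · exact Submodule.zero_mem _
  · exact gaussMap_mem n _

variable {M : ℕ → Type u} [∀ n, AddCommGroup (M n)] [∀ n, Module ℤ (M n)]
  (κ : ∀ n, M n ≃ₗ[ℤ] spanOf (fun c : C.cell n => IsCritical V c))

/-- The projection of the reduction defined by a vector field: the critical component of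
`1 - d h`. -/
def gaussProj (n : ℕ) : (C.cell n →₀ ℤ) →ₗ[ℤ] M n :=
  (κ n).symm.toLinearMap ∘ₗ
    (component (fun c : C.cell n => IsCritical V c)).codRestrict _ (component_mem _) ∘ₗ
      (LinearMap.id - C.bd n ∘ₗ gaussMap V n)

/-- The injection of the reduction defined by a vector field: the restriction of `1 - h d` to the
critical chains. -/
def gaussIncl (n : ℕ) : M n →ₗ[ℤ] (C.cell n →₀ ℤ) :=
  (LinearMap.id - gaussMapBd V n) ∘ₗ Submodule.subtype _ ∘ₗ (κ n).toLinearMap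

/-- The differential of the critical complex. -/
def gaussBd (n : ℕ) : M (n + 1) →ₗ[ℤ] M n :=
  gaussProj κ n ∘ₗ C.bd n ∘ₗ gaussIncl κ (n + 1)

lemma coe_gaussProj (n : ℕ) (x : C.cell n →₀ ℤ) :
    (κ n (gaussProj κ n x) : C.cell n →₀ ℤ) =
      component (IsCritical V) (x - C.bd n (gaussMap V n x)) := by
  simp [gaussProj]

lemma gaussProj_eq_zero_iff {n : ℕ} {x : C.cell n →₀ ℤ} :
    gaussProj κ n x = 0 ↔ component (IsCritical V) (x - C.bd n (gaussMap V n x)) = 0 := by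
  rw [← coe_gaussProj κ, ZeroMemClass.coe_eq_zero, LinearEquiv.map_eq_zero_iff]

lemma gaussIncl_apply (n : ℕ) (y : M n) :
    gaussIncl κ n y = (κ n y : C.cell n →₀ ℤ) - gaussMapBd V n (κ n y) := rfl

section

variable (hV : IsDiscreteVectorField V) (hwf : ∀ n, WellFounded (pathRel V n))

include hV hwf

lemma gaussMapBd_of_isTarget (n : ℕ) {x : C.cell n →₀ ℤ}
    (hx : x ∈ spanOf (fun t : C.cell n => IsTarget V t)) : gaussMapBd V n x = x := by
  obtain _ | n := n
  · exact (Finsupp.ext fun c => mem_spanOf_iff.1 hx c fun h => h).symm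
  · exact gaussMap_bd_of_isTarget hV (hwf n) hx

lemma gaussMap_gaussIncl (n : ℕ) (y : M n) : gaussMap V n (gaussIncl κ n y) = 0 := by
  rw [gaussIncl_apply, map_sub,
    gaussMap_eq_zero hV (hwf n) (fun _ hc => hc.1) (κ n y).2,
    gaussMap_eq_zero hV (hwf n) (fun _ ht hs => hV.not_isTarget_of_isSource hs ht)
      (gaussMapBd_mem n _), sub_zero]

lemma gaussProj_gaussIncl (n : ℕ) (y : M n) : gaussProj κ n (gaussIncl κ n y) = y := by
  refine (κ n).injective (Subtype.ext ?_)
  rw [coe_gaussProj, gaussMap_gaussIncl κ hV hwf, map_zero, sub_zero, gaussIncl_apply, map_sub,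
    component_eq_zero_of_disjoint (fun _ ht hc => hc.2 ht) (gaussMapBd_mem n _),
    component_eq_self_iff.2 (κ n y).2, sub_zero]

lemma gaussProj_gaussMap (n : ℕ) (x : C.cell n →₀ ℤ) :
    gaussProj κ (n + 1) (gaussMap V n x) = 0 := by
  rw [gaussProj_eq_zero_iff, gaussMap_gaussMap hV (hwf _), map_zero, sub_zero,
    component_critical_gaussMap]

lemma gaussProj_bd_gaussMap (n : ℕ) (x : C.cell n →₀ ℤ) :
    gaussProj κ n (C.bd n (gaussMap V n x)) = 0 := by
  rw [gaussProj_eq_zero_iff, gaussMap_bd_gaussMap hV (hwf n), sub_self, map_zero]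

lemma gaussMap_bd_gaussIncl (n : ℕ) (y : M (n + 1)) :
    gaussMap V n (C.bd n (gaussIncl κ (n + 1) y)) = 0 := by
  rw [gaussIncl_apply, map_sub, map_sub]
  exact sub_eq_zero.2 (gaussMap_bd_gaussMap hV (hwf n) _).symm

lemma gaussIncl_gaussProj (n : ℕ) (x : C.cell n →₀ ℤ) :
    gaussIncl κ n (gaussProj κ n x) = x - C.bd n (gaussMap V n x) - gaussMapBd V n x := by
  rw [gaussIncl_apply, coe_gaussProj]
  generalize hy : x - C.bd n (gaussMap V n x) = y
  have source_y : component (IsSource V) y = 0 := by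
    rw [← hy, map_sub, component_source_bd_gaussMap hV (hwf n), sub_self]
  have critical_y : component (IsCritical V) y = y - component (IsTarget V) y := by
    have h := hV.component_target_add_source_add_critical y
    rw [source_y, add_zero] at h
    exact eq_sub_of_add_eq' h
  have gaussMapBd_y : gaussMapBd V n y = gaussMapBd V n x := by
    rw [← hy, map_sub, gaussMapBd_bd, sub_zero]
  rw [critical_y, map_sub, gaussMapBd_of_isTarget hV hwf n (component_mem _ _), gaussMapBd_y]
  abel

lemma gaussIncl_gaussBd (n : ℕ) (y : M (n + 1)) :
    gaussIncl κ n (gaussBd κ n y) = C.bd n (gaussIncl κ (n + 1) y) := by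
  change gaussIncl κ n (gaussProj κ n (C.bd n (gaussIncl κ (n + 1) y))) = _
  rw [gaussIncl_gaussProj κ hV hwf, gaussMap_bd_gaussIncl κ hV hwf, gaussMapBd_bd, map_zero,
    sub_zero, sub_zero]

lemma gaussBd_gaussProj (n : ℕ) (x : C.cell (n + 1) →₀ ℤ) :
    gaussBd κ n (gaussProj κ (n + 1) x) = gaussProj κ n (C.bd n x) := by
  change gaussProj κ n (C.bd n (gaussIncl κ (n + 1) (gaussProj κ (n + 1) x))) = _
  rw [gaussIncl_gaussProj κ hV hwf, map_sub (C.bd n), map_sub (C.bd n), C.bd_bd, sub_zero, map_sub]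
  exact sub_eq_self.2 (gaussProj_bd_gaussMap κ hV hwf n _)

lemma gaussBd_comp_gaussBd (n : ℕ) : gaussBd κ n ∘ₗ gaussBd κ (n + 1) = 0 := by
  refine LinearMap.ext fun y => ?_
  change gaussProj κ n (C.bd n (gaussIncl κ (n + 1) (gaussBd κ (n + 1) y))) = 0
  rw [gaussIncl_gaussBd κ hV hwf, C.bd_bd, map_zero]

end

/-- The chain complex with the modules `M n` and the differential `d`. -/
abbrev complexOf (M : ℕ → Type u) [∀ n, AddCommGroup (M n)] [∀ n, Module ℤ (M n)]
    (d : ∀ n, M (n + 1) →ₗ[ℤ] M n) (hd : ∀ n, d n ∘ₗ d (n + 1) = 0) :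
    ChainComplex (ModuleCat.{u} ℤ) ℕ :=
  ChainComplex.of (fun n => ModuleCat.of ℤ (M n)) (fun n => ModuleCat.ofHom (d n))
    (fun n => by rw [← ModuleCat.ofHom_comp, hd]; rfl)

lemma complexOf_d (d : ∀ n, M (n + 1) →ₗ[ℤ] M n) (hd : ∀ n, d n ∘ₗ d (n + 1) = 0) (n : ℕ) :
    (complexOf M d hd).d (n + 1) n = ModuleCat.ofHom (d n) :=
  ChainComplex.of_d (fun n => ModuleCat.of ℤ (M n)) (fun n => ModuleCat.ofHom (d n)) n

lemma CellComplex.chain_d (n : ℕ) : C.chain.d (n + 1) n = ModuleCat.ofHom (C.bd n) :=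
  complexOf_d (M := fun n => C.cell n →₀ ℤ) C.bd C.bd_comp_bd n

variable (V) in
/-- The operator `gaussMap`, extended by zero to all pairs of degrees. -/
def gaussHom (i j : ℕ) : C.chain.X i ⟶ C.chain.X j :=
  if h : i + 1 = j then
    ModuleCat.ofHom (gaussMap V i) ≫ eqToHom (congrArg C.chain.X h)
  else 0

lemma gaussHom_succ (n : ℕ) : gaussHom V n (n + 1) = ModuleCat.ofHom (gaussMap V n) := by
  rw [gaussHom, dif_pos rfl]
  exact Category.comp_id _

lemma prevD_gaussHom (n : ℕ) :
    prevD n (gaussHom V) = ModuleCat.ofHom (C.bd n ∘ₗ gaussMap V n) := by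
  rw [prevD_eq _ (show (ComplexShape.down ℕ).Rel (n + 1) n from rfl), gaussHom_succ, C.chain_d]
  rfl

lemma dNext_gaussHom (n : ℕ) : dNext n (gaussHom V) = ModuleCat.ofHom (gaussMapBd V n) := by
  obtain _ | n := n
  · rw [dNext_eq_zero _ _ (by simp)]
    rfl
  · rw [dNext_eq _ (show (ComplexShape.down ℕ).Rel (n + 1) n from rfl), gaussHom_succ, C.chain_d]
    rfl

variable (hV : IsDiscreteVectorField V) (hwf : ∀ n, WellFounded (pathRel V n))

/-- The reduction defined by a vector field without infinite paths. -/
def gaussReduction : Reduction C.chain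
    (complexOf M (gaussBd κ) (gaussBd_comp_gaussBd κ hV hwf)) where
  f :=
    { f := fun n => ModuleCat.ofHom (gaussProj κ n)
      comm' := by
        rintro _ n rfl
        rw [complexOf_d, C.chain_d]
        exact ModuleCat.hom_ext (LinearMap.ext (gaussBd_gaussProj κ hV hwf n)) }
  g :=
    { f := fun n => ModuleCat.ofHom (gaussIncl κ n)
      comm' := by
        rintro _ n rfl
        rw [complexOf_d, C.chain_d]
        exact ModuleCat.hom_ext (LinearMap.ext fun y => (gaussIncl_gaussBd κ hV hwf n y).symm) }
  h :=
    { hom := gaussHom V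
      zero := fun i j hij => dif_neg hij
      comm := fun n => by
        rw [prevD_gaussHom, dNext_gaussHom]
        refine ModuleCat.hom_ext (LinearMap.ext fun x : C.cell n →₀ ℤ => ?_)
        change x = gaussMapBd V n x + C.bd n (gaussMap V n x) + gaussIncl κ n (gaussProj κ n x)
        rw [gaussIncl_gaussProj κ hV hwf]
        abel }
  g_f := HomologicalComplex.hom_ext _ _ fun n =>
    ModuleCat.hom_ext (LinearMap.ext (gaussProj_gaussIncl κ hV hwf n))
  h_f n := by
    change gaussHom V n (n + 1) ≫ _ = 0
    rw [gaussHom_succ]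
    exact ModuleCat.hom_ext (LinearMap.ext (gaussProj_gaussMap κ hV hwf n))
  g_h n := by
    change _ ≫ gaussHom V n (n + 1) = 0
    rw [gaussHom_succ]
    exact ModuleCat.hom_ext (LinearMap.ext (gaussMap_gaussIncl κ hV hwf n))
  h_h n := by
    change gaussHom V n (n + 1) ≫ gaussHom V (n + 1) (n + 2) = 0
    rw [gaussHom_succ, gaussHom_succ]
    exact ModuleCat.hom_ext (LinearMap.ext (gaussMap_gaussMap hV (hwf (n + 1))))

lemma gaussReduction_hMap (n : ℕ) : (gaussReduction κ hV hwf).hMap n = gaussMap V n :=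
  congrArg ModuleCat.Hom.hom (gaussHom_succ n)

lemma gaussReduction_isInducedBy : IsInducedBy (gaussReduction κ hV hwf) V κ where
  h_target n c hc := by
    rw [gaussReduction_hMap]
    exact gaussMap_single_of_not_isSource hV (hwf n) fun hs => hV.not_isTarget_of_isSource hs hc
  h_critical n c hc := by
    rw [gaussReduction_hMap]
    exact gaussMap_single_of_not_isSource hV (hwf n) hc.1
  h_source_mem n c _ := by
    rw [gaussReduction_hMap]
    exact gaussMap_mem n _
  d_h_source n c hc := by
    rw [gaussReduction_hMap, component_source_bd_gaussMap hV (hwf n),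
      component_eq_self_iff.2 (single_mem_spanOf hc 1)]
  h_d_target n c hc := by
    rw [gaussReduction_hMap, gaussMap_component_source hV (hwf n),
      gaussMap_bd_of_isTarget hV (hwf n) (single_mem_spanOf hc 1)]
  f_eq n x := by
    rw [gaussReduction_hMap]
    exact coe_gaussProj κ n x
  g_zero _ := sub_zero _
  g_succ n _ := by
    rw [gaussReduction_hMap]
    rfl

include hV hwf in
lemma exists_reduction_isInducedBy : ∃ (d : ∀ n, M (n + 1) →ₗ[ℤ] M n)
    (hd : ∀ n, d n ∘ₗ d (n + 1) = 0) (ρ : Reduction C.chain (complexOf M d hd)),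
    IsInducedBy ρ V κ :=
  ⟨_, _, _, gaussReduction_isInducedBy κ hV hwf⟩

end Reduction

end Gauss

/-! ### The canonical expression of a simplex -/

section Canonical

variable {X : SSet.{u}} {n m : ℕ}

instance (x : X _⦋n⦌) : Epi (degMap x) :=
  (X.exists_nonDegenerate x).choose_spec.choose_spec.choose

/-- The non-degenerate simplex in the canonical expression of a simplex. -/
def degCore (x : X _⦋n⦌) : X.nonDegenerate (geomDim x) :=
  (X.exists_nonDegenerate x).choose_spec.choose_spec.choose_spec.choose

lemma map_degMap (x : X _⦋n⦌) : X.map (degMap x).op (degCore x).1 = x :=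
  (X.exists_nonDegenerate x).choose_spec.choose_spec.choose_spec.choose_spec.symm

/-- The values of the surjection in the canonical expression of a simplex. -/
def degVal (x : X _⦋n⦌) (k : Fin (n + 1)) : ℕ := ((degMap x).toOrderHom k : ℕ)

lemma geomDim_eq {p : ℕ} (x : X _⦋n⦌) (f : ⦋n⦌ ⟶ ⦋p⦌) [Epi f] (y : X.nonDegenerate p)
    (h : x = X.map f.op y.1) : geomDim x = p :=
  X.unique_nonDegenerate_dim x (degMap x) (degCore x) (map_degMap x).symm f y h

lemma degVal_eq {p : ℕ} (x : X _⦋n⦌) (f : ⦋n⦌ ⟶ ⦋p⦌) [Epi f] (y : X.nonDegenerate p)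
    (h : x = X.map f.op y.1) (k : Fin (n + 1)) : degVal x k = f.toOrderHom k := by
  obtain rfl := geomDim_eq x f y h
  rw [degVal, X.unique_nonDegenerate_map x (degMap x) (degCore x) (map_degMap x).symm f y h]

lemma degMap_surjective (x : X _⦋n⦌) : Function.Surjective (degMap x).toOrderHom :=
  SimplexCategory.epi_iff_surjective.1 inferInstance

lemma degVal_le (x : X _⦋n⦌) (k : Fin (n + 1)) : degVal x k ≤ geomDim x :=
  Nat.le_of_lt_succ ((degMap x).toOrderHom k).isLt

lemma degVal_mono (x : X _⦋n⦌) : Monotone (degVal x) :=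
  fun _ _ h => (degMap x).toOrderHom.monotone h

lemma exists_degVal_eq (x : X _⦋n⦌) {a : ℕ} (ha : a ≤ geomDim x) : ∃ k, degVal x k = a := by
  obtain ⟨k, hk⟩ := degMap_surjective x ⟨a, Nat.lt_succ_of_le ha⟩
  exact ⟨k, congrArg Fin.val hk⟩

lemma degVal_zero (x : X _⦋n⦌) : degVal x 0 = 0 := by
  obtain ⟨k, hk⟩ := exists_degVal_eq x (Nat.zero_le _)
  have := degVal_mono x (Fin.zero_le k)
  omega

lemma degVal_last (x : X _⦋n⦌) : degVal x (Fin.last n) = geomDim x := by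
  obtain ⟨k, hk⟩ := exists_degVal_eq x le_rfl
  exact le_antisymm (degVal_le x _) (hk ▸ degVal_mono x (Fin.le_last k))

lemma degVal_step (x : X _⦋n⦌) (i : Fin n) :
    degVal x i.succ = degVal x i.castSucc ∨ degVal x i.succ = degVal x i.castSucc + 1 := by
  have h1 := degVal_mono x (Fin.castSucc_lt_succ (i := i)).le
  by_contra! h
  obtain ⟨k, hk⟩ := exists_degVal_eq x (a := degVal x i.castSucc + 1) (by
    have := degVal_le x i.succ; omega)
  rcases lt_or_ge k i.succ with hki | hki
  · have := degVal_mono x (show k ≤ i.castSucc from Nat.lt_succ_iff.1 hki)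
    omega
  · have := degVal_mono x hki
    omega

lemma map_eq_map_degCore (x : X _⦋n⦌) (f : ⦋m⦌ ⟶ ⦋n⦌) :
    X.map f.op x = X.map (f ≫ degMap x).op (degCore x).1 := by
  conv_lhs => rw [← map_degMap x]
  rw [op_comp, Functor.map_comp_apply]

section Map

variable (x : X _⦋n⦌) (f : ⦋m⦌ ⟶ ⦋n⦌)

lemma geomDim_map [Epi (f ≫ degMap x)] : geomDim (X.map f.op x) = geomDim x :=
  geomDim_eq _ (f ≫ degMap x) (degCore x) (map_eq_map_degCore x f)

lemma degVal_map [Epi (f ≫ degMap x)] (k : Fin (m + 1)) :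
    degVal (X.map f.op x) k = degVal x (f.toOrderHom k) :=
  degVal_eq _ (f ≫ degMap x) (degCore x) (map_eq_map_degCore x f) k

lemma geomDim_map_le : geomDim (X.map f.op x) ≤ n := by
  set y := X.map f.op x
  have hsplit := isSplitEpi_of_epi (degMap y)
  have h : X.map (section_ (degMap y) ≫ f).op x = (degCore y).1 := by
    rw [op_comp, Functor.map_comp_apply]
    change X.map (section_ (degMap y)).op y = _
    rw [map_eq_map_degCore y, IsSplitEpi.id]
    simp
  have := X.mono_of_nonDegenerate (degCore y) (section_ (degMap y) ≫ f) x h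
  exact SimplexCategory.len_le_of_mono (section_ (degMap y) ≫ f)

lemma geomDim_map_lt (h : ¬ Epi (f ≫ degMap x)) : geomDim (X.map f.op x) < geomDim x := by
  rw [map_eq_map_degCore]
  generalize f ≫ degMap x = g at h
  have hfac : X.map g.op (degCore x).1 =
      X.map (Limits.factorThruImage g).op (X.map (Limits.image.ι g).op (degCore x).1) := by
    rw [← Functor.map_comp_apply, ← op_comp, Limits.image.fac]
  have hlen : (Limits.image g).len < geomDim x := by
    refine lt_of_le_of_ne (SimplexCategory.len_le_of_mono (Limits.image.ι g)) fun he => h ?_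
    have : IsIso (Limits.image.ι g) := (SimplexCategory.isIso_iff_of_mono _).2 he
    rw [← Limits.image.fac g]
    infer_instance
  rw [hfac]
  exact (geomDim_map_le (n := (Limits.image g).len) _ _).trans_lt hlen

end Map

lemma degVal_σ (x : X _⦋n⦌) (i : Fin (n + 1)) (k : Fin (n + 2)) :
    degVal (X.σ i x) k = degVal x (i.predAbove k) :=
  have : Epi (SimplexCategory.σ i ≫ degMap x) := inferInstance
  degVal_map x (SimplexCategory.σ i) k

lemma mem_range_σ_iff (x : X _⦋n + 1⦌) (i : Fin (n + 1)) :
    x ∈ Set.range (X.σ i) ↔ degVal x i.succ = degVal x i.castSucc := by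
  refine ⟨?_, fun h => ?_⟩
  · rintro ⟨y, rfl⟩
    simp [degVal_σ]
  · obtain ⟨θ, hθ⟩ :=
      SimplexCategory.eq_σ_comp_of_not_injective' (degMap x) i (Fin.ext h.symm)
    refine ⟨X.map θ.op (degCore x).1, ?_⟩
    change X.map (SimplexCategory.σ i).op _ = x
    rw [← Functor.map_comp_apply, ← op_comp, ← hθ, map_degMap]

lemma σ_δ_castSucc_of_degVal_eq {x : X _⦋n + 1⦌} {i : Fin (n + 1)}
    (h : degVal x i.succ = degVal x i.castSucc) : X.σ i (X.δ i.castSucc x) = x := by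
  obtain ⟨y, rfl⟩ := (mem_range_σ_iff x i).2 h
  rw [SSet.δ_comp_σ_self_apply]

lemma σ_δ_succ_of_degVal_eq {x : X _⦋n + 1⦌} {i : Fin (n + 1)}
    (h : degVal x i.succ = degVal x i.castSucc) : X.σ i (X.δ i.succ x) = x := by
  obtain ⟨y, rfl⟩ := (mem_range_σ_iff x i).2 h
  rw [SSet.δ_comp_σ_succ_apply]

lemma epi_δ_comp_degMap_iff (x : X _⦋n + 1⦌) (k : Fin (n + 2)) :
    Epi (SimplexCategory.δ k ≫ degMap x) ↔ ∃ l, l ≠ k ∧ degVal x l = degVal x k := by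
  rw [SimplexCategory.epi_iff_surjective]
  refine ⟨fun h => ?_, fun ⟨l, hlk, hl⟩ a => ?_⟩
  · obtain ⟨i, hi⟩ := h ((degMap x).toOrderHom k)
    exact ⟨k.succAbove i, Fin.succAbove_ne k i, congrArg Fin.val hi⟩
  · obtain ⟨m, hmk, rfl⟩ : ∃ m, m ≠ k ∧ (degMap x).toOrderHom m = a := by
      obtain ⟨m, rfl⟩ := degMap_surjective x a
      by_cases hm : m = k
      · exact ⟨l, hlk, hm ▸ Fin.ext hl⟩
      · exact ⟨m, hm, rfl⟩
    obtain ⟨i, rfl⟩ := Fin.exists_succAbove_eq hmk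
    exact ⟨i, rfl⟩

section Face

variable {x : X _⦋n + 1⦌} {k : Fin (n + 2)}

lemma geomDim_δ (h : ∃ l, l ≠ k ∧ degVal x l = degVal x k) : geomDim (X.δ k x) = geomDim x :=
  have := (epi_δ_comp_degMap_iff x k).2 h
  geomDim_map x (SimplexCategory.δ k)

lemma degVal_δ (h : ∃ l, l ≠ k ∧ degVal x l = degVal x k) (i : Fin (n + 1)) :
    degVal (X.δ k x) i = degVal x (k.succAbove i) :=
  have := (epi_δ_comp_degMap_iff x k).2 h
  degVal_map x (SimplexCategory.δ k) i

lemma geomDim_δ_lt (h : ¬ ∃ l, l ≠ k ∧ degVal x l = degVal x k) :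
    geomDim (X.δ k x) < geomDim x :=
  geomDim_map_lt x (SimplexCategory.δ k) (mt (epi_δ_comp_degMap_iff x k).1 h)

end Face

end Canonical

/-! ### Lattice paths -/

section Steps

variable {n : ℕ} {π : Fin (n + 1) → ℕ × ℕ}

lemma isVertical_iff (i : Fin n) : IsVertical π i ↔
    (π i.succ).1 = (π i.castSucc).1 ∧ (π i.succ).2 = (π i.castSucc).2 + 1 := by
  simp [IsVertical, Prod.ext_iff]

lemma isHorizontal_iff (i : Fin n) : IsHorizontal π i ↔
    (π i.succ).1 = (π i.castSucc).1 + 1 ∧ (π i.succ).2 = (π i.castSucc).2 := by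
  simp [IsHorizontal, Prod.ext_iff]

lemma isDiagonal_iff (i : Fin n) : IsDiagonal π i ↔
    (π i.succ).1 = (π i.castSucc).1 + 1 ∧ (π i.succ).2 = (π i.castSucc).2 + 1 := by
  simp [IsDiagonal, Prod.ext_iff]

lemma IsVertical.not_isDiagonal {i : Fin n} (h : IsVertical π i) : ¬ IsDiagonal π i := by
  rw [isVertical_iff] at h
  rw [isDiagonal_iff]
  omega

lemma IsHorizontal.not_isDiagonal {i : Fin n} (h : IsHorizontal π i) : ¬ IsDiagonal π i := by
  rw [isHorizontal_iff] at h
  rw [isDiagonal_iff]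
  omega

lemma IsHorizontal.not_isVertical {i : Fin n} (h : IsHorizontal π i) : ¬ IsVertical π i := by
  rw [isHorizontal_iff] at h
  rw [isVertical_iff]
  omega

lemma IsBend.succ_eq {i j : Fin n} (h : IsBend π i j) : i.succ = j.castSucc := Fin.ext h.1

lemma IsBend.vertical {i j : Fin n} (h : IsBend π i j) :
    (π j.castSucc).1 = (π i.castSucc).1 ∧ (π j.castSucc).2 = (π i.castSucc).2 + 1 := by
  rw [← h.succ_eq]
  exact (isVertical_iff i).1 h.2.1

lemma IsBend.horizontal {i j : Fin n} (h : IsBend π i j) :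
    (π j.succ).1 = (π j.castSucc).1 + 1 ∧ (π j.succ).2 = (π j.castSucc).2 :=
  (isHorizontal_iff j).1 h.2.2

lemma IsBend.ne_zero {i j : Fin n} (h : IsBend π i j) : j.castSucc ≠ 0 :=
  h.succ_eq ▸ Fin.succ_ne_zero i

/-- A lattice path: each of its steps is vertical, horizontal or diagonal. -/
def IsLatticePath {n : ℕ} (π : Fin (n + 1) → ℕ × ℕ) : Prop :=
  ∀ i, IsVertical π i ∨ IsHorizontal π i ∨ IsDiagonal π i

namespace IsLatticePath

variable (hπ : IsLatticePath π)

include hπ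

lemma monotone : Monotone π := by
  rw [Fin.monotone_iff_le_succ]
  intro i
  have := hπ i
  rw [isVertical_iff, isHorizontal_iff, isDiagonal_iff] at this
  rw [Prod.le_def]
  omega

lemma isVertical_of_fst_eq {k : Fin (n + 1)} {i : Fin n} (hk : k ≤ i.castSucc)
    (h : (π k).1 = (π i.succ).1) : IsVertical π i := by
  have hmono : (π k).1 ≤ (π i.castSucc).1 := (hπ.monotone hk).1
  have hstep := hπ i
  rw [isVertical_iff, isHorizontal_iff, isDiagonal_iff] at hstep
  rw [isVertical_iff]
  omega

lemma isHorizontal_of_snd_eq {k : Fin (n + 1)} {j : Fin n} (hk : j.succ ≤ k)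
    (h : (π k).2 = (π j.castSucc).2) : IsHorizontal π j := by
  have hmono : (π j.succ).2 ≤ (π k).2 := (hπ.monotone hk).2
  have hstep := hπ j
  rw [isVertical_iff, isHorizontal_iff, isDiagonal_iff] at hstep
  rw [isHorizontal_iff]
  omega

lemma exists_isBend_or_exists_gt {k : Fin (n + 1)} (hcol : ∃ l, l ≠ k ∧ (π l).1 = (π k).1)
    (hrow : ∃ l, l ≠ k ∧ (π l).2 = (π k).2) :
    (∃ i j, IsBend π i j ∧ j.castSucc = k) ∨ ∃ l, k < l ∧ (π l).1 = (π k).1 := by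
  obtain ⟨l, hlk, hl⟩ := hcol
  rcases lt_or_gt_of_ne hlk with hlt | hgt
  swap
  · exact Or.inr ⟨l, hgt, hl⟩
  obtain ⟨i, rfl⟩ := Fin.exists_succ_eq.2 ((Fin.zero_le _).trans_lt hlt).ne'
  have hv := hπ.isVertical_of_fst_eq (Fin.le_castSucc_iff.2 hlt) hl
  obtain ⟨m, hmi, hm⟩ := hrow
  rcases lt_or_gt_of_ne hmi with hlt' | hgt'
  · have hmono : (π m).2 ≤ (π i.castSucc).2 := (hπ.monotone (Fin.le_castSucc_iff.2 hlt')).2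
    have hstep := (isVertical_iff i).1 hv
    omega
  · obtain ⟨j, hj⟩ := Fin.exists_castSucc_eq.2 (hgt'.trans_le (Fin.le_last _)).ne
    rw [← hj] at hgt' hm
    exact Or.inl ⟨i, j, ⟨congrArg Fin.val hj.symm, hv,
      hπ.isHorizontal_of_snd_eq (Fin.castSucc_lt_iff_succ_le.1 hgt') hm⟩, hj⟩

end IsLatticePath

end Steps

section Events

variable {n : ℕ} {π : Fin (n + 1) → ℕ × ℕ}

lemma EventFreeFrom.mono {k l : ℕ} (h : EventFreeFrom π k) (hkl : k ≤ l) : EventFreeFrom π l :=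
  fun i hi => h i (hkl.trans hi)

lemma IsSourcePath.not_isTargetPath (hs : IsSourcePath π) : ¬ IsTargetPath π := by
  rintro ⟨i', j', hb, hf'⟩
  obtain ⟨i, hd, hf⟩ := hs
  rcases lt_trichotomy (i : ℕ) i' with h | h | h
  · exact (hf i' h).2 j' hb
  · exact hb.2.1.not_isDiagonal (Fin.ext h ▸ hd)
  · exact (hf' i (hb.1 ▸ h)).1 hd

lemma isSourcePath_or_isTargetPath_or_isCriticalPath (π : Fin (n + 1) → ℕ × ℕ) :
    IsSourcePath π ∨ IsTargetPath π ∨ IsCriticalPath π := by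
  by_cases h : ∃ i, IsDiagonal π i ∨ ∃ j, IsBend π i j
  · obtain ⟨i, hi, hmax⟩ := (Set.toFinite {i | IsDiagonal π i ∨ ∃ j, IsBend π i j}).exists_maximal h
    have hf : EventFreeFrom π (i + 1) := by
      intro k hk
      rw [← not_exists, ← not_or]
      intro hk'
      exact absurd (hmax hk' (Nat.le_of_succ_le hk)) (not_le.2 hk)
    rcases hi with hd | ⟨j, hb⟩
    · exact Or.inl ⟨i, hd, hf⟩
    · exact Or.inr (Or.inl ⟨i, j, hb, hb.1 ▸ hf⟩)
  · push Not at h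
    exact Or.inr (Or.inr fun i _ => h i)

lemma isCriticalPath_iff : IsCriticalPath π ↔ ¬ IsSourcePath π ∧ ¬ IsTargetPath π := by
  refine ⟨fun h => ⟨?_, ?_⟩, fun h => ?_⟩
  · rintro ⟨i, hd, -⟩
    exact (h i (Nat.zero_le _)).1 hd
  · rintro ⟨i, j, hb, -⟩
    exact (h i (Nat.zero_le _)).2 j hb
  · exact ((isSourcePath_or_isTargetPath_or_isCriticalPath π).resolve_left h.1).resolve_left h.2

lemma first_diagonal_unique {i i' : Fin n} (hd : IsDiagonal π i) (hf : EventFreeFrom π (i + 1))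
    (hd' : IsDiagonal π i') (hf' : EventFreeFrom π (i' + 1)) : i = i' := by
  by_contra hne
  rcases Nat.lt_or_gt_of_ne (Fin.val_ne_of_ne hne) with h | h
  · exact (hf i' h).1 hd'
  · exact (hf' i h).1 hd

lemma first_bend_unique {i j i' j' : Fin n} (hb : IsBend π i j) (hf : EventFreeFrom π j)
    (hb' : IsBend π i' j') (hf' : EventFreeFrom π j') : j = j' := by
  have hij := hb.1
  have hij' := hb'.1
  by_contra hne
  rcases Nat.lt_or_gt_of_ne (Fin.val_ne_of_ne hne) with h | h
  · exact (hf i' (by omega)).2 j' hb'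
  · exact (hf' i (by omega)).2 j hb

end Events

section RemoveVertex

variable {n : ℕ} {π : Fin (n + 2) → ℕ × ℕ} {k : Fin (n + 2)} {i j : Fin n}

lemma removeNth_castSucc (hi : (k : ℕ) ≤ i) : k.removeNth π i.castSucc = π i.succ.castSucc :=
  congrArg π (Fin.succAbove_of_le_castSucc _ _ (by simpa [Fin.le_def] using hi))

lemma removeNth_succ (hi : (k : ℕ) ≤ i) : k.removeNth π i.succ = π i.succ.succ :=
  congrArg π (Fin.succAbove_of_le_castSucc _ _ (by
    simpa [Fin.le_def] using hi.trans (Nat.le_succ _)))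

lemma isDiagonal_removeNth (hi : (k : ℕ) ≤ i) :
    IsDiagonal (k.removeNth π) i ↔ IsDiagonal π i.succ := by
  rw [IsDiagonal, IsDiagonal, removeNth_castSucc hi, removeNth_succ hi]

lemma isVertical_removeNth (hi : (k : ℕ) ≤ i) :
    IsVertical (k.removeNth π) i ↔ IsVertical π i.succ := by
  rw [IsVertical, IsVertical, removeNth_castSucc hi, removeNth_succ hi]

lemma isHorizontal_removeNth (hi : (k : ℕ) ≤ i) :
    IsHorizontal (k.removeNth π) i ↔ IsHorizontal π i.succ := by
  rw [IsHorizontal, IsHorizontal, removeNth_castSucc hi, removeNth_succ hi]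

lemma isBend_removeNth (hi : (k : ℕ) ≤ i) :
    IsBend (k.removeNth π) i j ↔ IsBend π i.succ j.succ := by
  simp only [IsBend, Fin.val_succ, Nat.add_right_cancel_iff]
  refine and_congr_right fun hij => ?_
  rw [isVertical_removeNth hi, isHorizontal_removeNth (by omega)]

lemma eventFreeFrom_removeNth {m : ℕ} (hk : (k : ℕ) ≤ m) :
    EventFreeFrom (k.removeNth π) m ↔ EventFreeFrom π (m + 1) := by
  refine ⟨fun h i hi => ?_, fun h i hi => ?_⟩
  · obtain ⟨i, rfl⟩ := Fin.exists_succ_eq.2 (show i ≠ 0 by rintro rfl; simp at hi)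
    simp only [Fin.val_succ, Nat.add_le_add_iff_right] at hi
    rw [← isDiagonal_removeNth (hk.trans hi)]
    refine ⟨(h i hi).1, fun j hb => ?_⟩
    obtain ⟨j, rfl⟩ := Fin.exists_succ_eq.2 (show j ≠ 0 by rintro rfl; simpa using hb.1)
    exact (h i hi).2 j ((isBend_removeNth (hk.trans hi)).2 hb)
  · rw [isDiagonal_removeNth (hk.trans hi)]
    have := h i.succ (by simpa using hi)
    exact ⟨this.1, fun j hb => this.2 j.succ ((isBend_removeNth (hk.trans hi)).1 hb)⟩

lemma IsBend.isDiagonal_removeNth {i : Fin n} (hb : IsBend π i.castSucc i.succ) :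
    IsDiagonal (i.succ.castSucc.removeNth π) i := by
  have hv := hb.vertical
  have hh := hb.horizontal
  rw [isDiagonal_iff, Fin.removeNth_apply, Fin.removeNth_apply,
    Fin.succAbove_of_castSucc_lt _ i.castSucc (by simp [Fin.lt_def]),
    Fin.succAbove_of_le_castSucc _ i.succ le_rfl]
  omega

lemma IsBend.eventFreeFrom_removeNth {i : Fin n} (hb : IsBend π i.castSucc i.succ) :
    EventFreeFrom (i.succ.castSucc.removeNth π) (i + 1) ↔ EventFreeFrom π (i + 1) := by
  rw [TwistedEZ.eventFreeFrom_removeNth (by simp)]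
  refine ⟨fun h l hl => ?_, fun h => h.mono (Nat.le_succ _)⟩
  by_cases hli : l = i.succ
  · subst hli
    exact ⟨hb.2.2.not_isDiagonal, fun j hb' => hb.2.2.not_isVertical hb'.2.1⟩
  · exact h l (lt_of_le_of_ne hl fun h => hli (Fin.ext h.symm))

lemma isTargetPath_removeNth {i j : Fin (n + 1)} (hb : IsBend π i j) (hf : EventFreeFrom π j)
    (hk : (k : ℕ) < i) : IsTargetPath (k.removeNth π) := by
  have hij := hb.1
  obtain ⟨i, rfl⟩ := Fin.exists_succ_eq.2 (show i ≠ 0 by rintro rfl; simp at hk)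
  obtain ⟨j, rfl⟩ := Fin.exists_succ_eq.2 (show j ≠ 0 by rintro rfl; simp at hij)
  simp only [Fin.val_succ] at hij hk hf
  exact ⟨i, j, (isBend_removeNth (by omega)).2 hb, (eventFreeFrom_removeNth (by omega)).2 hf⟩

/-- The other bends of the path are met after its first event; removing the vertex of one of them
does not change this event. -/
lemma IsLatticePath.exists_gt_of_not_isTargetPath (hπ : IsLatticePath π) {i j : Fin (n + 1)}
    (hb : IsBend π i j) (hf : EventFreeFrom π j) (hkj : k ≠ j.castSucc)
    (hk : ¬ IsTargetPath (k.removeNth π)) (hcol : ∃ l, l ≠ k ∧ (π l).1 = (π k).1)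
    (hrow : ∃ l, l ≠ k ∧ (π l).2 = (π k).2) : ∃ l, k < l ∧ (π l).1 = (π k).1 := by
  refine (hπ.exists_isBend_or_exists_gt hcol hrow).resolve_left ?_
  rintro ⟨i', j', hb', rfl⟩
  have hij := hb.1
  have hij' := hb'.1
  have hj'i : j' ≠ i := fun h => hb'.2.2.not_isVertical (h ▸ hb.2.1)
  rcases lt_trichotomy (j' : ℕ) i with hlt | heq | hgt
  · exact hk (isTargetPath_removeNth hb hf hlt)
  · exact hj'i (Fin.ext heq)
  · have hne : (j' : ℕ) ≠ j := fun h => hkj (congrArg Fin.castSucc (Fin.ext h))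
    exact (hf i' (by omega)).2 j' hb'

end RemoveVertex

section PointsAbove

variable {n : ℕ} {a : ℕ × ℕ}

/-- The point `a` of the lattice lies strictly above the path `π`. -/
def IsAbovePath (π : Fin (n + 1) → ℕ × ℕ) (a : ℕ × ℕ) : Prop :=
  ∀ k, (π k).1 = a.1 → (π k).2 < a.2

lemma not_isAbovePath (π : Fin (n + 1) → ℕ × ℕ) (k : Fin (n + 1)) : ¬ IsAbovePath π (π k) :=
  fun h => (h k rfl).false

variable {π : Fin (n + 2) → ℕ × ℕ} {k : Fin (n + 2)}

lemma IsAbovePath.removeNth (h : IsAbovePath π a) (k : Fin (n + 2)) :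
    IsAbovePath (k.removeNth π) a :=
  fun l => h (k.succAbove l)

lemma isAbovePath_of_removeNth (hπ : Monotone π)
    (hk : ∃ l, k < l ∧ (π l).1 = (π k).1) (h : IsAbovePath (k.removeNth π) a) :
    IsAbovePath π a := by
  have hne : ∀ l, l ≠ k → (π l).1 = a.1 → (π l).2 < a.2 := fun l hl hla => by
    obtain ⟨m, rfl⟩ := Fin.exists_succAbove_eq hl
    exact h m hla
  intro l hla
  by_cases hlk : l = k
  · subst hlk
    obtain ⟨m, hlm, hm⟩ := hk
    exact (hπ hlm.le).2.trans_lt (hne m hlm.ne' (hm.trans hla))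
  · exact hne l hlk hla

lemma IsBend.isAbovePath_removeNth {i j : Fin (n + 1)} (hb : IsBend π i j) (hπ : Monotone π) :
    IsAbovePath (j.castSucc.removeNth π) (π j.castSucc) := by
  intro l hl
  rw [Fin.removeNth_apply] at hl ⊢
  have hv := hb.vertical
  have hh := hb.horizontal
  rcases lt_or_gt_of_ne (Fin.succAbove_ne j.castSucc l) with hlt | hgt
  · have hmono : π (j.castSucc.succAbove l) ≤ π i.castSucc :=
      hπ (Fin.le_castSucc_iff.2 (hb.succ_eq ▸ hlt))
    rw [Prod.le_def] at hmono
    omega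
  · have hmono : π j.succ ≤ π (j.castSucc.succAbove l) := hπ (Fin.castSucc_lt_iff_succ_le.1 hgt)
    rw [Prod.le_def] at hmono
    omega

lemma IsBend.injective_of_removeNth {i j : Fin (n + 1)} (hb : IsBend π i j) (hπ : Monotone π)
    (h : Function.Injective (j.castSucc.removeNth π)) : Function.Injective π := by
  have hne : ∀ l, π (j.castSucc.succAbove l) ≠ π j.castSucc := fun l hl =>
    (hb.isAbovePath_removeNth hπ l (congrArg Prod.fst hl)).ne (congrArg Prod.snd hl)
  intro l m hlm
  obtain rfl | ⟨l, rfl⟩ := j.castSucc.eq_self_or_eq_succAbove l <;>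
    obtain rfl | ⟨m, rfl⟩ := j.castSucc.eq_self_or_eq_succAbove m
  · rfl
  · exact absurd hlm.symm (hne m)
  · exact absurd hlm (hne l)
  · rw [h hlm]

end PointsAbove

namespace IsCriticalPath

variable {n : ℕ} {π : Fin (n + 1) → ℕ × ℕ} (hc : IsCriticalPath π) (hπ : IsLatticePath π)
  (hzero : π 0 = 0)

include hc hπ

lemma isVertical_or_isHorizontal (i : Fin n) :
    IsVertical π i ∨ IsHorizontal π i :=
  (hπ i).imp_right fun h => h.resolve_right (hc i (Nat.zero_le _)).1

include hzero

lemma fst_add_snd (k : Fin (n + 1)) : (π k).1 + (π k).2 = k := by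
  induction k using Fin.induction with
  | zero => simp [hzero]
  | succ i ih =>
    have := hc.isVertical_or_isHorizontal hπ i
    rw [isVertical_iff, isHorizontal_iff] at this
    simp only [Fin.val_succ, Fin.val_castSucc] at ih ⊢
    omega

lemma snd_eq_zero_or_isVertical (i : Fin n) :
    (π i.succ).2 = 0 ∨ IsVertical π i := by
  obtain _ | n := n
  · exact i.elim0
  refine or_iff_not_imp_right.2 fun hv => ?_
  have hh := (hc.isVertical_or_isHorizontal hπ i).resolve_left hv
  rw [((isHorizontal_iff i).1 hh).2]
  induction i using Fin.induction with
  | zero => simp [hzero]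
  | succ i ih =>
    have hv' : ¬ IsVertical π i.castSucc := fun h =>
      (hc i.castSucc (Nat.zero_le _)).2 i.succ ⟨rfl, h, hh⟩
    have hh' := (hc.isVertical_or_isHorizontal hπ i.castSucc).resolve_left hv'
    exact ((isHorizontal_iff _).1 hh').2.trans (ih hv' hh')

lemma fst_eq_fst_last (k : Fin (n + 1)) (hk : (π k).2 ≠ 0) :
    (π k).1 = (π (Fin.last n)).1 := by
  induction k using Fin.reverseInduction with
  | last => rfl
  | cast i ih =>
    have hi : (π i.castSucc).2 ≤ (π i.succ).2 := (hπ.monotone (Fin.castSucc_le_succ i)).2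
    have hv := (hc.snd_eq_zero_or_isVertical hπ hzero i).resolve_left (by omega)
    rw [← ((isVertical_iff i).1 hv).1]
    exact ih (by omega)

lemma apply_eq (k : Fin (n + 1)) :
    π k = (min (k : ℕ) (π (Fin.last n)).1, (k : ℕ) - (π (Fin.last n)).1) := by
  have hsum := hc.fst_add_snd hπ hzero k
  have hfst := hc.fst_eq_fst_last hπ hzero k
  have hle : (π k).1 ≤ (π (Fin.last n)).1 := (hπ.monotone (Fin.le_last k)).1
  ext <;> dsimp only <;> omega

end IsCriticalPath

/-! ### The paths of the simplices of a product -/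

section SimplexPath

variable {X Y : SSet.{u}} {n : ℕ}

lemma monotone_sPath (r : (X ⊗ Y : SSet.{u}) _⦋n⦌) : Monotone (sPath r) :=
  fun _ _ h => ⟨degVal_mono r.1 h, degVal_mono r.2 h⟩

lemma sPath_zero (r : (X ⊗ Y : SSet.{u}) _⦋n⦌) : sPath r 0 = 0 :=
  Prod.ext (degVal_zero r.1) (degVal_zero r.2)

lemma sPath_last (r : (X ⊗ Y : SSet.{u}) _⦋n⦌) : sPath r (Fin.last n) = bidim r :=
  Prod.ext (degVal_last r.1) (degVal_last r.2)

lemma sPath_le_bidim (r : (X ⊗ Y : SSet.{u}) _⦋n⦌) (k : Fin (n + 1)) : sPath r k ≤ bidim r :=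
  sPath_last r ▸ monotone_sPath r (Fin.le_last k)

lemma mem_range_σ_prod_iff (r : (X ⊗ Y : SSet.{u}) _⦋n + 1⦌) (i : Fin (n + 1)) :
    r ∈ Set.range ((X ⊗ Y : SSet.{u}).σ i) ↔ sPath r i.succ = sPath r i.castSucc := by
  refine Iff.trans ?_ (((mem_range_σ_iff r.1 i).and (mem_range_σ_iff r.2 i)).trans
    (Prod.ext_iff (x := sPath r i.succ) (y := sPath r i.castSucc)).symm)
  exact ⟨fun ⟨y, hy⟩ => ⟨⟨y.1, congrArg Prod.fst hy⟩, ⟨y.2, congrArg Prod.snd hy⟩⟩,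
    fun ⟨⟨x, hx⟩, ⟨y, hy⟩⟩ => ⟨(x, y), Prod.ext hx hy⟩⟩

lemma mem_nonDegenerate_prod_iff (r : (X ⊗ Y : SSet.{u}) _⦋n⦌) :
    r ∈ (X ⊗ Y : SSet.{u}).nonDegenerate n ↔ Function.Injective (sPath r) := by
  obtain _ | n := n
  · rw [SSet.nondegenerate_zero]
    exact iff_of_true (Set.mem_univ _) fun a b _ => Subsingleton.elim (α := Fin 1) a b
  · rw [SSet.mem_nonDegenerate_iff_notMem_degenerate, SSet.degenerate_eq_iUnion_range_σ,
      Set.mem_iUnion, not_exists]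
    simp only [mem_range_σ_prod_iff]
    refine ⟨fun h => StrictMono.injective (Fin.strictMono_iff_lt_succ.2 fun i => ?_),
      fun h i hi => Fin.castSucc_lt_succ.ne' (h hi)⟩
    exact (monotone_sPath r (Fin.castSucc_le_succ i)).lt_of_ne (Ne.symm (h i))

lemma isLatticePath_sPath {r : (X ⊗ Y : SSet.{u}) _⦋n⦌}
    (hr : r ∈ (X ⊗ Y : SSet.{u}).nonDegenerate n) : IsLatticePath (sPath r) := by
  intro i
  have hne : sPath r i.succ ≠ sPath r i.castSucc := fun h =>
    Fin.castSucc_lt_succ.ne' ((mem_nonDegenerate_prod_iff r).1 hr h)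
  have hfst := degVal_step r.1 i
  have hsnd := degVal_step r.2 i
  rw [isVertical_iff, isHorizontal_iff, isDiagonal_iff]
  rw [ne_eq, Prod.ext_iff] at hne
  simp only [sPath, degVal] at hne hfst hsnd ⊢
  omega

section Face

variable {r : (X ⊗ Y : SSet.{u}) _⦋n + 1⦌} {k : Fin (n + 2)}

lemma bidim_δ (hcol : ∃ l, l ≠ k ∧ (sPath r l).1 = (sPath r k).1)
    (hrow : ∃ l, l ≠ k ∧ (sPath r l).2 = (sPath r k).2) :
    bidim ((X ⊗ Y : SSet.{u}).δ k r) = bidim r :=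
  Prod.ext (geomDim_δ hcol) (geomDim_δ hrow)

lemma sPath_δ (hcol : ∃ l, l ≠ k ∧ (sPath r l).1 = (sPath r k).1)
    (hrow : ∃ l, l ≠ k ∧ (sPath r l).2 = (sPath r k).2) :
    sPath ((X ⊗ Y : SSet.{u}).δ k r) = k.removeNth (sPath r) :=
  funext fun i => Prod.ext (degVal_δ hcol i) (degVal_δ hrow i)

end Face

end SimplexPath

section EZField

variable {X Y : SSet.{u}} {n : ℕ}

section BendFace

variable {r : (X ⊗ Y : SSet.{u}) _⦋n + 1⦌} {i j : Fin (n + 1)} (hb : IsBend (sPath r) i j)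

include hb

lemma IsBend.exists_fst_eq : ∃ l, l ≠ j.castSucc ∧ (sPath r l).1 = (sPath r j.castSucc).1 :=
  ⟨i.castSucc, hb.succ_eq ▸ Fin.castSucc_lt_succ.ne, hb.vertical.1.symm⟩

lemma IsBend.exists_snd_eq : ∃ l, l ≠ j.castSucc ∧ (sPath r l).2 = (sPath r j.castSucc).2 :=
  ⟨j.succ, Fin.castSucc_lt_succ.ne', hb.horizontal.2⟩

lemma IsBend.bidim_δ : bidim ((X ⊗ Y : SSet.{u}).δ j.castSucc r) = bidim r :=
  TwistedEZ.bidim_δ hb.exists_fst_eq hb.exists_snd_eq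

lemma IsBend.sPath_δ :
    sPath ((X ⊗ Y : SSet.{u}).δ j.castSucc r) = j.castSucc.removeNth (sPath r) :=
  TwistedEZ.sPath_δ hb.exists_fst_eq hb.exists_snd_eq

lemma IsBend.δ_mem_nonDegenerate_iff :
    (X ⊗ Y : SSet.{u}).δ j.castSucc r ∈ (X ⊗ Y : SSet.{u}).nonDegenerate n ↔
      r ∈ (X ⊗ Y : SSet.{u}).nonDegenerate (n + 1) := by
  rw [mem_nonDegenerate_prod_iff, mem_nonDegenerate_prod_iff, hb.sPath_δ]
  exact ⟨hb.injective_of_removeNth (monotone_sPath r),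
    fun h => h.comp Fin.succAbove_right_injective⟩

end BendFace

section InsertBend

variable {r : (X ⊗ Y : SSet.{u}) _⦋n⦌} {i : Fin n}

/-- The simplex whose path is obtained from that of `r` by inserting a vertex in the upper left
corner of the step `i`. If this step is diagonal, it is replaced by a vertical and a horizontal
one. -/
def insertBend (r : (X ⊗ Y : SSet.{u}) _⦋n⦌) (i : Fin n) : (X ⊗ Y : SSet.{u}) _⦋n + 1⦌ :=
  (X.σ i.castSucc r.1, Y.σ i.succ r.2)

lemma sPath_insertBend (k : Fin (n + 2)) : sPath (insertBend r i) k =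
    ((sPath r (i.castSucc.predAbove k)).1, (sPath r (i.succ.predAbove k)).2) :=
  Prod.ext (degVal_σ _ _ _) (degVal_σ _ _ _)

lemma δ_insertBend : (X ⊗ Y : SSet.{u}).δ i.succ.castSucc (insertBend r i) = r :=
  Prod.ext (SSet.δ_comp_σ_succ_apply (S := X) i.castSucc r.1)
    (SSet.δ_comp_σ_self_apply (S := Y) i.succ r.2)

lemma insertBend_δ {r : (X ⊗ Y : SSet.{u}) _⦋n + 1⦌}
    (hb : IsBend (sPath r) i.castSucc i.succ) :
    insertBend ((X ⊗ Y : SSet.{u}).δ i.succ.castSucc r) i = r :=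
  Prod.ext (σ_δ_succ_of_degVal_eq hb.vertical.1) (σ_δ_castSucc_of_degVal_eq hb.horizontal.2)

lemma isBend_insertBend (hd : IsDiagonal (sPath r) i) :
    IsBend (sPath (insertBend r i)) i.castSucc i.succ := by
  have hbefore : sPath (insertBend r i) i.castSucc.castSucc = sPath r i.castSucc := by
    rw [sPath_insertBend, Fin.predAbove_castSucc_self,
      Fin.predAbove_castSucc_of_le _ _ (Fin.castSucc_le_succ i)]
  have hcorner : sPath (insertBend r i) i.succ.castSucc =
      ((sPath r i.castSucc).1, (sPath r i.succ).2) := by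
    rw [sPath_insertBend, Fin.predAbove_castSucc_self, ← Fin.succ_castSucc,
      Fin.predAbove_succ_self]
  have hafter : sPath (insertBend r i) i.succ.succ = sPath r i.succ := by
    rw [sPath_insertBend, Fin.predAbove_succ_self,
      Fin.predAbove_succ_of_le _ _ (Fin.castSucc_le_succ i)]
  rw [isDiagonal_iff] at hd
  refine ⟨rfl, (isVertical_iff _).2 ?_, (isHorizontal_iff _).2 ?_⟩
  · rw [Fin.succ_castSucc, hcorner, hbefore]
    exact ⟨rfl, hd.2⟩
  · rw [hafter, hcorner]
    exact ⟨hd.1, rfl⟩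

end InsertBend

variable {s s' : (normalizedComplex (X ⊗ Y)).cell n}
  {t t' : (normalizedComplex (X ⊗ Y)).cell (n + 1)}

lemma ezField_iff_eq_δ : ezField X Y n s t ↔ ∃ i : Fin n,
    IsBend (sPath t.1) i.castSucc i.succ ∧ EventFreeFrom (sPath t.1) (i + 1) ∧
      s.1 = (X ⊗ Y : SSet.{u}).δ i.succ.castSucc t.1 := by
  refine ⟨?_, fun ⟨i, hb, hf, hs⟩ => ⟨i.castSucc, i.succ, hb, by simpa using hf, hs⟩⟩
  rintro ⟨i, j, hb, hf, hs⟩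
  have hij := hb.1
  obtain ⟨j, rfl⟩ := Fin.exists_succ_eq.2 (show j ≠ 0 by rintro rfl; simp at hij)
  obtain rfl : i = j.castSucc := Fin.ext (by simpa using hij)
  exact ⟨j, hb, by simpa using hf, hs⟩

lemma ezField_iff_eq_insertBend : ezField X Y n s t ↔ ∃ i : Fin n,
    IsDiagonal (sPath s.1) i ∧ EventFreeFrom (sPath s.1) (i + 1) ∧ t.1 = insertBend s.1 i := by
  rw [ezField_iff_eq_δ]
  refine exists_congr fun i => ⟨?_, ?_⟩
  · rintro ⟨hb, hf, hs⟩
    rw [hs, hb.sPath_δ, insertBend_δ hb]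
    exact ⟨hb.isDiagonal_removeNth, hb.eventFreeFrom_removeNth.2 hf, rfl⟩
  · rintro ⟨hd, hf, ht⟩
    have hb := isBend_insertBend hd
    rw [← δ_insertBend (r := s.1) (i := i), hb.sPath_δ] at hf
    rw [ht]
    exact ⟨hb, hb.eventFreeFrom_removeNth.1 hf, δ_insertBend.symm⟩

lemma isTargetPath_iff_exists_ezField (t : (normalizedComplex (X ⊗ Y)).cell (n + 1)) :
    IsTargetPath (sPath t.1) ↔ ∃ s, ezField X Y n s t :=
  ⟨fun ⟨i, j, hb, hf⟩ => ⟨⟨_, hb.δ_mem_nonDegenerate_iff.2 t.2⟩, i, j, hb, hf, rfl⟩,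
    fun ⟨_, i, j, hb, hf, _⟩ => ⟨i, j, hb, hf⟩⟩

lemma isSourcePath_iff_exists_ezField (s : (normalizedComplex (X ⊗ Y)).cell n) :
    IsSourcePath (sPath s.1) ↔ ∃ t, ezField X Y n s t := by
  simp only [ezField_iff_eq_insertBend]
  refine ⟨fun ⟨i, hd, hf⟩ => ?_, fun ⟨_, i, hd, hf, _⟩ => ⟨i, hd, hf⟩⟩
  have hs : (X ⊗ Y : SSet.{u}).δ i.succ.castSucc (insertBend s.1 i) ∈
      (X ⊗ Y : SSet.{u}).nonDegenerate n := δ_insertBend ▸ s.2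
  exact ⟨⟨_, (isBend_insertBend hd).δ_mem_nonDegenerate_iff.1 hs⟩, i, hd, hf, rfl⟩

lemma ezField_source_unique (h : ezField X Y n s t) (h' : ezField X Y n s' t) : s = s' := by
  obtain ⟨i, j, hb, hf, hs⟩ := h
  obtain ⟨i', j', hb', hf', hs'⟩ := h'
  obtain rfl := first_bend_unique hb hf hb' hf'
  exact Subtype.ext (hs.trans hs'.symm)

lemma ezField_target_unique (h : ezField X Y n s t) (h' : ezField X Y n s t') : t = t' := by
  obtain ⟨i, hd, hf, ht⟩ := ezField_iff_eq_insertBend.1 h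
  obtain ⟨i', hd', hf', ht'⟩ := ezField_iff_eq_insertBend.1 h'
  obtain rfl := first_diagonal_unique hd hf hd' hf'
  exact Subtype.ext (ht.trans ht'.symm)

end EZField

section PointsAbove

variable {X Y : SSet.{u}} {m n : ℕ} {r : (X ⊗ Y : SSet.{u}) _⦋n⦌} {s : (X ⊗ Y : SSet.{u}) _⦋m⦌}

lemma pointsAbove_lt (hb : bidim r = bidim s)
    (h : ∀ a, IsAbovePath (sPath r) a → IsAbovePath (sPath s) a) {a : ℕ × ℕ} (ha : a ≤ bidim s)
    (hs : IsAbovePath (sPath s) a) (hr : ¬ IsAbovePath (sPath r) a) :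
    pointsAbove r < pointsAbove s := by
  classical
  unfold pointsAbove
  rw [hb]
  refine Finset.card_lt_card ((Finset.ssubset_iff_of_subset fun b hb => ?_).2 ⟨a, ?_, ?_⟩)
  · rw [Finset.mem_filter] at hb ⊢
    exact hb.imp_right (h b)
  · simp only [Finset.mem_filter, Finset.mem_product, Finset.mem_range]
    exact ⟨⟨Nat.lt_succ_of_le ha.1, Nat.lt_succ_of_le ha.2⟩, hs⟩
  · exact fun ha => hr (Finset.mem_filter.1 ha).2

/-- The vertex of the bend lies above the path which skips it, but on that of `∂ₖ t`. -/
lemma pointsAbove_δ_lt_of_isBend {t : (X ⊗ Y : SSet.{u}) _⦋n + 1⦌}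
    (ht : t ∈ (X ⊗ Y : SSet.{u}).nonDegenerate (n + 1)) {i j : Fin (n + 1)}
    (hb : IsBend (sPath t) i j) (hf : EventFreeFrom (sPath t) j) {k : Fin (n + 2)}
    (hkj : k ≠ j.castSucc) (hcol : ∃ l, l ≠ k ∧ (sPath t l).1 = (sPath t k).1)
    (hrow : ∃ l, l ≠ k ∧ (sPath t l).2 = (sPath t k).2)
    (hk : ¬ IsTargetPath (sPath ((X ⊗ Y : SSet.{u}).δ k t))) :
    pointsAbove ((X ⊗ Y : SSet.{u}).δ k t) < pointsAbove ((X ⊗ Y : SSet.{u}).δ j.castSucc t) := by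
  rw [sPath_δ hcol hrow] at hk
  have habove := (isLatticePath_sPath ht).exists_gt_of_not_isTargetPath hb hf hkj hk hcol hrow
  refine pointsAbove_lt (a := sPath t j.castSucc) ((bidim_δ hcol hrow).trans hb.bidim_δ.symm)
    (fun a ha => ?_) (hb.bidim_δ ▸ sPath_le_bidim t _) ?_ ?_
  · rw [sPath_δ hcol hrow] at ha
    rw [hb.sPath_δ]
    exact (isAbovePath_of_removeNth (monotone_sPath t) habove ha).removeNth _
  · rw [hb.sPath_δ]
    exact hb.isAbovePath_removeNth (monotone_sPath t)
  · obtain ⟨l, hl⟩ := Fin.exists_succAbove_eq hkj.symm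
    rw [sPath_δ hcol hrow, ← hl]
    exact not_isAbovePath (k.removeNth (sPath t)) l

end PointsAbove

/-! ### Incidence numbers of normalized chains -/

section Incidence

variable {X : SSet.{u}} {n : ℕ}

lemma simplexChain_apply (x : X _⦋n⦌) (s : X.nonDegenerate n) [Decidable (x = s.1)] :
    simplexChain X x s = if x = s.1 then 1 else 0 := by
  classical
  by_cases hx : x ∈ X.nonDegenerate n
  · rw [simplexChain_of_nonDegenerate X ⟨x, hx⟩, Finsupp.single_apply]
    exact if_congr Subtype.ext_iff rfl rfl
  · rw [if_neg (fun h : x = s.1 => hx (h ▸ s.2)),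
      simplexChain_of_degenerate X (by simpa [SSet.nonDegenerate] using hx)]
    rfl

lemma normBd_single_apply [DecidableEq (X _⦋n⦌)] (s : X.nonDegenerate n)
    (t : X.nonDegenerate (n + 1)) : normBd X n (Finsupp.single t 1) s =
      ∑ k : Fin (n + 2), if X.δ k t.1 = s.1 then (-1 : ℤ) ^ (k : ℕ) else 0 := by
  rw [← simplexChain_of_nonDegenerate, normBd_simplexChain, Finsupp.finsetSum_apply]
  refine Finset.sum_congr rfl fun k _ => ?_
  rw [Finsupp.smul_apply, simplexChain_apply, smul_eq_mul, mul_ite, mul_one, mul_zero]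

variable {s : (normalizedComplex X).cell n} {t : (normalizedComplex X).cell (n + 1)}

lemma incidence_eq_sum [DecidableEq (X _⦋n⦌)] : incidence (normalizedComplex X) s t =
    ∑ k : Fin (n + 2), if X.δ k t.1 = s.1 then (-1 : ℤ) ^ (k : ℕ) else 0 :=
  normBd_single_apply s t

lemma exists_eq_δ_of_isFace (h : IsFace (normalizedComplex X) s t) : ∃ k, s.1 = X.δ k t.1 := by
  classical
  rw [IsFace, incidence_eq_sum] at h
  obtain ⟨k, -, hk⟩ := Finset.exists_ne_zero_of_sum_ne_zero h
  exact ⟨k, by_contra fun hne => hk (if_neg (Ne.symm hne))⟩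

lemma isRegularFace_of_unique {k : Fin (n + 2)} (hk : X.δ k t.1 = s.1)
    (hunique : ∀ l, X.δ l t.1 = s.1 → l = k) : IsRegularFace (normalizedComplex X) s t := by
  classical
  rw [IsRegularFace, incidence_eq_sum, Finset.sum_eq_single k
    (fun l _ hl => if_neg (mt (hunique l) hl)) (by simp), if_pos hk]
  exact neg_one_pow_eq_or ℤ k

end Incidence

/-! ### The Eilenberg-Zilber vector field of a twisted product -/

section Twisted

variable {G : SimplicialObject GrpCat.{w}} {F B : SSet.{u}}
  (act : SimplicialAction G F) (τ : TwistingFunction G B) {n : ℕ}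

lemma twistedProduct_δ_of_ne_zero {k : Fin (n + 2)} (hk : k ≠ 0) (r : (F ⊗ B : SSet.{u}) _⦋n + 1⦌) :
    (twistedProduct act τ).δ k r = (F ⊗ B : SSet.{u}).δ k r := by
  obtain ⟨k, rfl⟩ := Fin.exists_succ_eq.2 hk
  exact twistedProduct_δ_succ act τ k r.1 r.2

/-- If `k = 0`, then `r.2` is of the form `σ₀ b`, on which `τ` is trivial. -/
lemma twistedProduct_δ_of_degVal_eq {k : Fin (n + 2)} (r : (F ⊗ B : SSet.{u}) _⦋n + 1⦌)
    (hrow : ∃ l, l ≠ k ∧ (sPath r l).2 = (sPath r k).2) :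
    (twistedProduct act τ).δ k r = (F ⊗ B : SSet.{u}).δ k r := by
  by_cases hk : k = 0
  swap
  · exact twistedProduct_δ_of_ne_zero act τ hk r
  subst hk
  obtain ⟨x, b⟩ := r
  obtain ⟨l, hl0, hl⟩ := hrow
  have hle : degVal b (Fin.succ 0) ≤ degVal b l := degVal_mono b (Fin.pos_of_ne_zero hl0)
  have hl' : degVal b l = degVal b 0 := hl
  have hdeg : degVal b (Fin.succ 0) = degVal b (Fin.castSucc 0) := by
    have := degVal_zero b
    rw [Fin.castSucc_zero]
    omega
  have hτ : τ.τ n b = 1 := by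
    rw [← σ_δ_castSucc_of_degVal_eq hdeg]
    exact τ.σ_zero n _
  rw [twistedProduct_δ_zero, hτ, act.one_smul]
  rfl

lemma twistedProduct_δ_cases {r : (F ⊗ B : SSet.{u}) _⦋n + 1⦌} {k : Fin (n + 2)}
    {r' : (F ⊗ B : SSet.{u}) _⦋n⦌} (h : r' = (twistedProduct act τ).δ k r) :
    (bidim r').2 < (bidim r).2 ∨ ((bidim r').2 = (bidim r).2 ∧ (bidim r').1 < (bidim r).1) ∨
      (r' = (F ⊗ B : SSet.{u}).δ k r ∧ (∃ l, l ≠ k ∧ (sPath r l).1 = (sPath r k).1) ∧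
        ∃ l, l ≠ k ∧ (sPath r l).2 = (sPath r k).2) := by
  by_cases hrow : ∃ l, l ≠ k ∧ (sPath r l).2 = (sPath r k).2
  · obtain rfl : r' = (F ⊗ B : SSet.{u}).δ k r :=
      h.trans (twistedProduct_δ_of_degVal_eq act τ r hrow)
    by_cases hcol : ∃ l, l ≠ k ∧ (sPath r l).1 = (sPath r k).1
    · exact Or.inr (Or.inr ⟨rfl, hcol, hrow⟩)
    · exact Or.inr (Or.inl ⟨geomDim_δ hrow, geomDim_δ_lt hcol⟩)
  · have hbase : r'.2 = B.δ k r.2 := congrArg Prod.snd h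
    left
    change geomDim r'.2 < _
    rw [hbase]
    exact geomDim_δ_lt hrow

variable {act τ}

lemma eq_of_twistedProduct_δ_eq {r : (F ⊗ B : SSet.{u}) _⦋n + 1⦌}
    (hr : r ∈ (F ⊗ B : SSet.{u}).nonDegenerate (n + 1)) {i j : Fin (n + 1)}
    (hb : IsBend (sPath r) i j) {k : Fin (n + 2)}
    (h : (F ⊗ B : SSet.{u}).δ j.castSucc r = (twistedProduct act τ).δ k r) : k = j.castSucc := by
  have hbidim := hb.bidim_δ
  rcases twistedProduct_δ_cases act τ h with hlt | ⟨-, hlt⟩ | ⟨hk, hcol, hrow⟩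
  · exact absurd (hbidim ▸ hlt) (lt_irrefl _)
  · exact absurd (hbidim ▸ hlt) (lt_irrefl _)
  · have hpath := congrArg sPath hk
    rw [hb.sPath_δ, sPath_δ hcol hrow] at hpath
    exact Fin.succAbove_left_injective (funext fun l =>
      (mem_nonDegenerate_prod_iff r).1 hr (congrFun hpath.symm l))

lemma twistedEZField_isRegularFace {s : (normalizedComplex (twistedProduct act τ)).cell n}
    {t : (normalizedComplex (twistedProduct act τ)).cell (n + 1)}
    (h : twistedEZField act τ n s t) : IsRegularFace _ s t := by
  obtain ⟨i, j, hb, -, hs⟩ := h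
  exact isRegularFace_of_unique ((twistedProduct_δ_of_ne_zero act τ hb.ne_zero _).trans hs.symm)
    fun k hk => eq_of_twistedProduct_δ_eq (untwist act τ t).2 hb (hs.symm.trans hk.symm)

variable (act τ)

lemma untwist_injective : Function.Injective
    (untwist act τ : (normalizedComplex (twistedProduct act τ)).cell n → _) :=
  fun _ _ h => Subtype.ext (congrArg Subtype.val h :)

/-- A non-degenerate simplex of `F × B`, seen as a non-degenerate simplex of `F ×_τ B`. -/
def retwist (c : (normalizedComplex (F ⊗ B)).cell n) :
    (normalizedComplex (twistedProduct act τ)).cell n :=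
  ⟨c.1, (mem_nonDegenerate_twistedProduct_iff act τ c.1).2 c.2⟩

lemma isSource_twistedEZField_iff (c : (normalizedComplex (twistedProduct act τ)).cell n) :
    IsSource (twistedEZField act τ) c ↔ IsSourcePath (sPath (untwist act τ c).1) := by
  rw [isSourcePath_iff_exists_ezField]
  exact ⟨fun ⟨t, ht⟩ => ⟨_, ht⟩, fun ⟨t, ht⟩ => ⟨retwist act τ t, ht⟩⟩

lemma isTarget_twistedEZField_iff (c : (normalizedComplex (twistedProduct act τ)).cell n) :
    IsTarget (twistedEZField act τ) c ↔ IsTargetPath (sPath (untwist act τ c).1) := by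
  obtain _ | n := n
  · exact ⟨fun h => h.elim, fun ⟨i, _⟩ => i.elim0⟩
  · rw [isTargetPath_iff_exists_ezField]
    exact ⟨fun ⟨s, hs⟩ => ⟨_, hs⟩, fun ⟨s, hs⟩ => ⟨retwist act τ s, hs⟩⟩

lemma isCritical_twistedEZField_iff (c : (normalizedComplex (twistedProduct act τ)).cell n) :
    IsCritical (twistedEZField act τ) c ↔ IsCriticalPath (sPath (untwist act τ c).1) := by
  rw [IsCritical, isSource_twistedEZField_iff, isTarget_twistedEZField_iff, isCriticalPath_iff]

lemma twistedEZField_isDiscreteVectorField : IsDiscreteVectorField (twistedEZField act τ) where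
  regular h := twistedEZField_isRegularFace h
  target_unique h h' := untwist_injective act τ (ezField_target_unique h h')
  source_unique h h' := untwist_injective act τ (ezField_source_unique h h')
  not_source_of_target h h' :=
    ((isSourcePath_iff_exists_ezField _).2 ⟨_, h'⟩).not_isTargetPath
      ((isTargetPath_iff_exists_ezField _).2 ⟨_, h⟩)

lemma twistedEZField_isLyapunov : IsLyapunov (twistedEZField act τ) (fun _ c =>
    toLex ((bidim (untwist act τ c).1).2,
      toLex ((bidim (untwist act τ c).1).1, pointsAbove (untwist act τ c).1))) := by
  intro n s s' t t' hst hst' hface hne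
  obtain ⟨k, hk⟩ := exists_eq_δ_of_isFace hface
  have hs' := ((isSourcePath_iff_exists_ezField (untwist act τ s')).2 ⟨_, hst'⟩).not_isTargetPath
  obtain ⟨i, j, hb, hf, hs⟩ := hst
  simp only [Prod.Lex.toLex_lt_toLex]
  rw [hs, hb.bidim_δ]
  rcases twistedProduct_δ_cases act τ (r := (untwist act τ t).1) (r' := (untwist act τ s').1) hk
    with hlt | hlt | ⟨hk', hcol, hrow⟩
  · exact Or.inl hlt
  · exact Or.inr (hlt.imp_right Or.inl)
  have hkj : k ≠ j.castSucc := by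
    rintro rfl
    exact hne (untwist_injective act τ (Subtype.ext (hk'.trans hs.symm)))
  rw [hk'] at hs' ⊢
  rw [bidim_δ hcol hrow]
  exact Or.inr ⟨rfl, Or.inr ⟨rfl,
    pointsAbove_δ_lt_of_isBend (untwist act τ t).2 hb hf hkj hcol hrow hs'⟩⟩

end Twisted

/-! ### The critical cells -/

section LastSimplex

variable {X Y : SSet.{u}} {p q : ℕ}

instance epi_lastLeft : Epi (lastLeft p q) := by
  rw [SimplexCategory.epi_iff_surjective]
  intro a
  have ha : (a : ℕ) < p + 1 := a.isLt
  refine ⟨(⟨a, by omega⟩ : Fin (p + q + 1)), Fin.ext ?_⟩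
  change min (a : ℕ) p = a
  omega

instance epi_lastRight : Epi (lastRight p q) := by
  rw [SimplexCategory.epi_iff_surjective]
  intro a
  have ha : (a : ℕ) < q + 1 := a.isLt
  refine ⟨(⟨p + a, by omega⟩ : Fin (p + q + 1)), Fin.ext ?_⟩
  change p + (a : ℕ) - p = a
  omega

section

variable (x : X.nonDegenerate p) (y : Y.nonDegenerate q)

lemma bidim_lastSimplex : bidim (X := X) (Y := Y) (lastSimplex x.1 y.1) = (p, q) :=
  Prod.ext (geomDim_eq _ (lastLeft p q) x rfl) (geomDim_eq _ (lastRight p q) y rfl)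

lemma sPath_lastSimplex (k : Fin (p + q + 1)) :
    sPath (X := X) (Y := Y) (lastSimplex x.1 y.1) k = (min (k : ℕ) p, (k : ℕ) - p) :=
  Prod.ext (degVal_eq _ (lastLeft p q) x rfl k) (degVal_eq _ (lastRight p q) y rfl k)

lemma lastSimplex_mem_nonDegenerate :
    lastSimplex x.1 y.1 ∈ (X ⊗ Y : SSet.{u}).nonDegenerate (p + q) := by
  refine (mem_nonDegenerate_prod_iff (X := X) (Y := Y) _).2 fun k l hkl => Fin.ext ?_
  rw [sPath_lastSimplex, sPath_lastSimplex, Prod.mk.injEq] at hkl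
  omega

lemma isCriticalPath_lastSimplex :
    IsCriticalPath (sPath (X := X) (Y := Y) (lastSimplex x.1 y.1)) := by
  refine fun i _ => ⟨?_, ?_⟩
  · rw [isDiagonal_iff, sPath_lastSimplex, sPath_lastSimplex]
    simp only [Fin.val_succ, Fin.val_castSucc]
    omega
  · rintro j ⟨hij, hv, hh⟩
    rw [isVertical_iff, sPath_lastSimplex, sPath_lastSimplex] at hv
    rw [isHorizontal_iff, sPath_lastSimplex, sPath_lastSimplex] at hh
    simp only [Fin.val_succ, Fin.val_castSucc] at hv hh
    omega

variable {x y} in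
lemma eq_and_eq_of_lastSimplex_eq {x' : X.nonDegenerate p} {y' : Y.nonDegenerate q}
    (h : lastSimplex x.1 y.1 = lastSimplex x'.1 y'.1) : x = x' ∧ y = y' :=
  ⟨X.unique_nonDegenerate_simplex _ (lastLeft p q) x rfl (lastLeft p q) x' (congrArg Prod.fst h),
    Y.unique_nonDegenerate_simplex _ (lastRight p q) y rfl (lastRight p q) y'
      (congrArg Prod.snd h)⟩

end

lemma exists_nonDegenerate_map_eq {n : ℕ} {x : X _⦋n⦌} (hp : geomDim x = p) (f : ⦋n⦌ ⟶ ⦋p⦌)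
    (hf : ∀ k, degVal x k = f.toOrderHom k) : ∃ y : X.nonDegenerate p, X.map f.op y.1 = x := by
  subst hp
  obtain rfl : degMap x = f :=
    SimplexCategory.Hom.ext _ _ (OrderHom.ext _ _ (funext fun k => Fin.ext (hf k)))
  exact ⟨degCore x, map_degMap x⟩

lemma exists_eq_lastSimplex {r : (X ⊗ Y : SSet.{u}) _⦋p + q⦌} (hbidim : bidim r = (p, q))
    (hr : r ∈ (X ⊗ Y : SSet.{u}).nonDegenerate (p + q)) (hc : IsCriticalPath (sPath r)) :
    ∃ (x : X.nonDegenerate p) (y : Y.nonDegenerate q), lastSimplex x.1 y.1 = r := by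
  have hpath := hc.apply_eq (isLatticePath_sPath hr) (sPath_zero r)
  rw [sPath_last, hbidim] at hpath
  obtain ⟨x, hx⟩ := exists_nonDegenerate_map_eq (congrArg Prod.fst hbidim) (lastLeft p q)
    fun k => congrArg Prod.fst (hpath k)
  obtain ⟨y, hy⟩ := exists_nonDegenerate_map_eq (congrArg Prod.snd hbidim) (lastRight p q)
    fun k => congrArg Prod.snd (hpath k)
  exact ⟨x, y, Prod.ext hx hy⟩

lemma bidim_add_of_isCriticalPath {n : ℕ} {r : (X ⊗ Y : SSet.{u}) _⦋n⦌}
    (hr : r ∈ (X ⊗ Y : SSet.{u}).nonDegenerate n) (hc : IsCriticalPath (sPath r)) :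
    (bidim r).1 + (bidim r).2 = n := by
  have hsum := hc.fst_add_snd (isLatticePath_sPath hr) (sPath_zero r) (Fin.last n)
  rwa [sPath_last] at hsum

end LastSimplex

section TensorBasis

variable (X Y : SSet.{u}) (n : ℕ)

/-- The index set of the generators `x ⊗ y` of degree `n`: the pairs of non-degenerate simplices
of complementary dimensions. -/
abbrev TensorIndex : Type u :=
  Σ pq : Finset.HasAntidiagonal.antidiagonal n, X.nonDegenerate pq.1.1 × Y.nonDegenerate pq.1.2

/-- The basis of the tensor product consisting of the generators `x ⊗ y`. -/
def tensorBasis : Module.Basis (TensorIndex X Y n) ℤ (TensorModule X Y n) :=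
  DFinsupp.basis fun pq : Finset.HasAntidiagonal.antidiagonal n =>
    (Finsupp.basisSingleOne (R := ℤ) (ι := X.nonDegenerate pq.1.1)).tensorProduct
      (Finsupp.basisSingleOne (R := ℤ) (ι := Y.nonDegenerate pq.1.2))

variable {X Y}

lemma tensorBasis_apply {p q : ℕ} (x : X.nonDegenerate p) (y : Y.nonDegenerate q) :
    tensorBasis X Y (p + q)
      ⟨⟨(p, q), Finset.HasAntidiagonal.mem_antidiagonal.2 rfl⟩, (x, y)⟩ = tensorGen x y := by
  rw [Module.Basis.apply_eq_iff, ← LinearEquiv.eq_symm_apply]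
  change DirectSum.lof ℤ _ _ _ _ = (DFinsupp.mapRange.linearEquiv
    fun pq : Finset.HasAntidiagonal.antidiagonal (p + q) =>
    ((Finsupp.basisSingleOne (R := ℤ) (ι := X.nonDegenerate pq.1.1)).tensorProduct
      (Finsupp.basisSingleOne (R := ℤ) (ι := Y.nonDegenerate pq.1.2))).repr.symm)
    (sigmaFinsuppEquivDFinsupp (Finsupp.single _ 1))
  rw [sigmaFinsuppEquivDFinsupp_single]
  refine Eq.trans ?_ (DFinsupp.mapRange_single (hf := fun _ => map_zero _)).symm
  rw [Module.Basis.repr_symm_single_one, Module.Basis.tensorProduct_apply]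
  simp only [Finsupp.coe_basisSingleOne]
  rfl

end TensorBasis

section SpanBasis

variable {C : CellComplex.{u}} {n : ℕ} (P : C.cell n → Prop)

/-- The basis of the chains supported by the cells with the property `P`. -/
def spanBasis : Module.Basis {c // P c} ℤ (spanOf P) :=
  .ofRepr (Finsupp.supportedEquivFinsupp {c | P c})

lemma coe_spanBasis (c : {c // P c}) :
    (spanBasis P c : C.cell n →₀ ℤ) = Finsupp.single c.1 1 :=
  Finsupp.supportedEquivFinsupp_symm_single _ _ _

end SpanBasis

section CriticalEquiv

variable {G : SimplicialObject GrpCat.{w}} {F B : SSet.{u}}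
  (act : SimplicialAction G F) (τ : TwistingFunction G B) {n : ℕ}

/-- The critical cells of dimension `n` of `F ×_τ B`. -/
abbrev CriticalCell (n : ℕ) : Type u :=
  {c : (normalizedComplex (twistedProduct act τ)).cell n // IsCritical (twistedEZField act τ) c}

/-- The critical cell over a pair of non-degenerate simplices. -/
def criticalCellOfPair {p q : ℕ} (x : F.nonDegenerate p) (y : B.nonDegenerate q) :
    CriticalCell act τ (p + q) :=
  ⟨retwist act τ ⟨lastSimplex x.1 y.1, lastSimplex_mem_nonDegenerate x y⟩,
    (isCritical_twistedEZField_iff act τ _).2 (isCriticalPath_lastSimplex x y)⟩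

/-- `criticalCellOfPair`, transported to the total degree `n` along `p + q = n`. -/
def criticalCell (a : TensorIndex F B n) : CriticalCell act τ n :=
  Finset.HasAntidiagonal.mem_antidiagonal.1 a.1.2 ▸ criticalCellOfPair act τ a.2.1 a.2.2

lemma bidim_criticalCell (a : TensorIndex F B n) :
    bidim (untwist act τ (criticalCell act τ a).1).1 = a.1.1 := by
  obtain ⟨⟨⟨p, q⟩, h⟩, x, y⟩ := a
  obtain rfl := Finset.HasAntidiagonal.mem_antidiagonal.1 h
  exact bidim_lastSimplex x y

lemma criticalCell_injective : Function.Injective (criticalCell act τ (n := n)) := by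
  intro a a' haa'
  have hbidim : a.1.1 = a'.1.1 := by
    rw [← bidim_criticalCell act τ, haa', bidim_criticalCell]
  obtain ⟨⟨⟨p, q⟩, h⟩, x, y⟩ := a
  obtain ⟨⟨pq, h'⟩, x', y'⟩ := a'
  obtain rfl : (p, q) = pq := hbidim
  obtain rfl := Finset.HasAntidiagonal.mem_antidiagonal.1 h
  obtain ⟨rfl, rfl⟩ := eq_and_eq_of_lastSimplex_eq (congrArg (fun c => c.1.1) haa')
  rfl

lemma criticalCell_surjective : Function.Surjective (criticalCell act τ (n := n)) := by
  rintro ⟨c, hc⟩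
  have hpath := (isCritical_twistedEZField_iff act τ c).1 hc
  obtain ⟨p, q, hbidim⟩ : ∃ p q, bidim (untwist act τ c).1 = (p, q) := ⟨_, _, rfl⟩
  obtain rfl : p + q = n := by
    simpa only [hbidim] using bidim_add_of_isCriticalPath (untwist act τ c).2 hpath
  obtain ⟨x, y, hxy⟩ := exists_eq_lastSimplex hbidim (untwist act τ c).2 hpath
  exact ⟨⟨⟨(p, q), Finset.HasAntidiagonal.mem_antidiagonal.2 rfl⟩, (x, y)⟩,
    Subtype.ext (Subtype.ext hxy)⟩

variable (n) in
/-- The identification of the tensor product with the free module on the critical cells. -/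
def criticalEquiv : TensorModule F B n ≃ₗ[ℤ]
    spanOf (fun c : (normalizedComplex (twistedProduct act τ)).cell n =>
      IsCritical (twistedEZField act τ) c) :=
  (tensorBasis F B n).equiv (spanBasis _)
    (Equiv.ofBijective _ ⟨criticalCell_injective act τ, criticalCell_surjective act τ⟩)

lemma coe_criticalEquiv_tensorGen {p q : ℕ} (x : F.nonDegenerate p) (y : B.nonDegenerate q) :
    (criticalEquiv act τ (p + q) (tensorGen x y) :
        (normalizedComplex (twistedProduct act τ)).cell (p + q) →₀ ℤ) =
      simplexChain (twistedProduct act τ) (lastSimplex x.1 y.1) := by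
  rw [← tensorBasis_apply, criticalEquiv, Module.Basis.equiv_apply, coe_spanBasis]
  exact (simplexChain_of_nonDegenerate (twistedProduct act τ) _).symm

end CriticalEquiv

end TwistedEZ

end

theorem mainTheorem4 {G : SimplicialObject GrpCat.{w}} {F B : SSet.{u}}
    (act : SimplicialAction G F) (τ : TwistingFunction G B) :
    -- the vector field of `F × B` is a vector field on `F ×_τ B`, with the same status of the cells
    IsDiscreteVectorField (twistedEZField act τ) ∧
    (∀ n (c : (normalizedComplex (twistedProduct act τ)).cell n),
      (IsSource (twistedEZField act τ) c ↔ IsSourcePath (sPath (untwist act τ c).1)) ∧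
      (IsTarget (twistedEZField act τ) c ↔ IsTargetPath (sPath (untwist act τ c).1)) ∧
      (IsCritical (twistedEZField act τ) c ↔ IsCriticalPath (sPath (untwist act τ c).1))) ∧
    -- it has a lexicographic Lyapunov function and is admissible
    IsLyapunov (twistedEZField act τ) (fun n c => toLex ((bidim (untwist act τ c).1).2,
      toLex ((bidim (untwist act τ c).1).1, pointsAbove (untwist act τ c).1))) ∧
    IsAdmissible (twistedEZField act τ) ∧
    -- the reduction which it defines
    ∃ (d : ∀ n, TensorModule F B (n + 1) →ₗ[ℤ] TensorModule F B n)
      (hd : ∀ n, d n ∘ₗ d (n + 1) = 0)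
      (ρ : Reduction (normalizedComplex (twistedProduct act τ)).chain (twistedTensor F B d hd))
      (κ : ∀ n, TensorModule F B n ≃ₗ[ℤ]
        spanOf (fun c : (normalizedComplex (twistedProduct act τ)).cell n =>
          IsCritical (twistedEZField act τ) c)),
      (∀ p q (x : F.nonDegenerate p) (y : B.nonDegenerate q),
        (κ (p + q) (tensorGen x y) :
            (normalizedComplex (twistedProduct act τ)).cell (p + q) →₀ ℤ) =
          simplexChain (twistedProduct act τ) (lastSimplex x.1 y.1)) ∧
      IsInducedBy ρ (twistedEZField act τ) κ := by
  have hV := twistedEZField_isDiscreteVectorField act τ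
  have hL := twistedEZField_isLyapunov act τ
  have hwf := hL.wellFounded_pathRel
  refine ⟨hV, fun n c => ⟨isSource_twistedEZField_iff act τ c, isTarget_twistedEZField_iff act τ c,
    isCritical_twistedEZField_iff act τ c⟩, hL, hV.isAdmissible hwf, ?_⟩
  obtain ⟨d, hd, ρ, hρ⟩ := exists_reduction_isInducedBy (M := TensorModule F B)
    (fun n => criticalEquiv act τ n) hV hwf
  exact ⟨d, hd, ρ, fun n => criticalEquiv act τ n,
    fun _ _ x y => coe_criticalEquiv_tensorGen act τ x y, hρ⟩
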